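/- Let $\mathscr A$ be a cocomplete abelian category with exact coproducts. For a small category $\mathscr C$ let $\Delta/\mathscr C$ be its simplex category: objects are pairs $([n],f)$ with $f:[n]\to\mathscr C$ a functor, and morphisms $([n],f)\to([m],g)$ are the order preserving maps $\sigma:[n]\to[m]$ with $f=g\circ\sigma$. For a functor $T:(\Delta/\mathscr C)^{op}\to\mathscr A$ let $H_n^{Th}(\mathscr C,T)$ be the $n$-th homology of the Thomason chain complex $C_n^{Th}(\mathscr C,T)=\bigoplus_{f:[n]\to\mathscr C}T(f)$, whose differential is given on the summand of $f:[n+1]\to\mathscr C$ by $\sum_{i=0}^{n+1}(-1)^i(\delta^i)^*$, where $(\delta^i)^*:T(f)\to T(f\circ\delta^i)$ is induced by the $i$-th coface map $\delta^i:[n]\to[n+1]$. For a small category $I$ and $D:I\to\mathscr A$, let $-\,\overline\otimes_I D:\mathfrak{Fun}(I^{op},\mathfrak{Ab})\to\mathscr A$ be the symbolic tensor product, i.e. the left adjoint of $X\mapsto \mathrm{Hom}_{\mathscr A}(D(-),X)$; let $\mathrm{Tor}_n^I(-,D)$ be its $n$-th left derived functor (computed by projective resolutions in $\mathfrak{Fun}(I^{op},\mathfrak{Ab})$),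 and let $\underline{\mathbb Z}:I^{op}\to\mathfrak{Ab}$ be the constant functor with value $\mathbb Z$. Let $\mathrm{colim}_n^I$, $n\ge 0$, denote the left derived functors (left satellites) of $\mathrm{colim}^I:\mathfrak{Fun}(I,\mathscr A)\to\mathscr A$, i.e. the universal homological $\delta$-functor with $\mathrm{colim}_0^I\cong\mathrm{colim}^I$. Write $H_n(I,D)$ for $\mathrm{colim}_n^I D$. Then for every small category $\mathscr C$ the derived functors $\mathrm{colim}_n^{(\Delta/\mathscr C)^{op}}$ exist, and for all $n\ge 0$, all small categories $\mathscr C$ and all $T:(\Delta/\mathscr C)^{op}\to\mathscr A$ there are isomorphisms $$H_n^{Th}(\mathscr C,T)\;\cong\;\mathrm{Tor}_n^{(\Delta/\mathscr C)^{op}}(\underline{\mathbb Z},T)\;\cong\;\mathrm{colim}_n^{(\Delta/\mathscr C)^{op}}T\;=\;H_n((\Delta/\mathscr C)^{op},T).$$ These isomorphisms are natural in $\mathscr C$ and in $T$: they are natural transformations of functors of $T$ for fixed $\mathscr C$, and they commute with the maps induced by every pair $(\varphi,\tau)$ consisting of a functor $\varphi:\mathscr C\to\mathscr C'$ and a natural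 transformation $\tau:T\to T'\circ(\Delta/\varphi)^{op}$. -/

import Mathlib

open CategoryTheory CategoryTheory.Limits Opposite

universe v u

noncomputable section

namespace Thomason

/-! ### The simplex category of a small category -/

/-- An object `([n], f)` of the simplex category `Δ/C`: an object `[n]` of `Δ` and a functor
`f : [n] ⥤ C`, that is, an `n`-simplex of the nerve of `C`. -/
structure SimplexOver (C : Type v) [SmallCategory.{v} C] : Type v where
  /-- the object `[n]` of `Δ` -/
  dim : SimplexCategory
  /-- the functor `[n] ⥤ C` -/
  diagram : (nerve C).obj (op dim)

namespace SimplexOver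

variable {C : Type v} [SmallCategory.{v} C]

/-- A morphism `([n], f) ⟶ ([m], g)` in `Δ/C`: a morphism `σ : [n] ⟶ [m]` of `Δ`
with `f = g ∘ σ`. -/
@[ext]
structure Hom (x y : SimplexOver C) : Type v where
  /-- the underlying morphism of `Δ` -/
  toHom : x.dim ⟶ y.dim
  w : (nerve C).map toHom.op y.diagram = x.diagram

instance : SmallCategory (SimplexOver C) where
  Hom := Hom
  id x := ⟨𝟙 _, rfl⟩
  comp f g := ⟨f.toHom ≫ g.toHom, by rw [← f.w, ← g.w]; rfl⟩

/-- The morphism `([n], g ∘ σ) ⟶ ([m], g)` of `Δ/C` given by `σ : [n] ⟶ [m]`. -/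
def ofHom {a b : SimplexCategory} (σ : a ⟶ b) (g : (nerve C).obj (op b)) :
    (⟨a, (nerve C).map σ.op g⟩ : SimplexOver C) ⟶ ⟨b, g⟩ := Hom.mk σ rfl

/-- The functor `Δ/φ : Δ/C ⥤ Δ/C'`, `([n], f) ↦ ([n], φ ∘ f)`. -/
def map {C' : Type v} [SmallCategory.{v} C'] (φ : C ⥤ C') : SimplexOver C ⥤ SimplexOver C' where
  obj x := ⟨x.dim, (nerveMap φ).app (op x.dim) x.diagram⟩
  map f := Hom.mk f.toHom (by rw [← f.w]; rfl)

end SimplexOver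

/-! ### Thomason homology -/

section Homology

variable {A : Type u} [Category.{v} A] [HasColimits A]

/-- The coproduct of the `T(f)` over all `f : [n] ⥤ C`. -/
def coprodSimplices {C : Type v} [SmallCategory.{v} C] (T : (SimplexOver C)ᵒᵖ ⥤ A)
    (n : SimplexCategoryᵒᵖ) : A :=
  ∐ fun f : (nerve C).obj n => T.obj (op ⟨n.unop, f⟩)

/-- The inclusion of the summand `T(f)`. -/
def coprodSimplicesι {C : Type v} [SmallCategory.{v} C] (T : (SimplexOver C)ᵒᵖ ⥤ A)
    (n : SimplexCategoryᵒᵖ) (f : (nerve C).obj n) :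
    T.obj (op ⟨n.unop, f⟩) ⟶ coprodSimplices T n :=
  Sigma.ι (fun f : (nerve C).obj n => T.obj (op ⟨n.unop, f⟩)) f

/-- The morphism from the coproduct of the `T(f)` with given components. -/
def coprodSimplicesDesc {C : Type v} [SmallCategory.{v} C] (T : (SimplexOver C)ᵒᵖ ⥤ A)
    (n : SimplexCategoryᵒᵖ) {X : A} (p : ∀ f : (nerve C).obj n, T.obj (op ⟨n.unop, f⟩) ⟶ X) :
    coprodSimplices T n ⟶ X :=
  Sigma.desc p

@[simp]
lemma coprodSimplicesι_desc {C : Type v} [SmallCategory.{v} C] (T : (SimplexOver C)ᵒᵖ ⥤ A)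
    (n : SimplexCategoryᵒᵖ) {X : A} (p : ∀ f : (nerve C).obj n, T.obj (op ⟨n.unop, f⟩) ⟶ X)
    (f : (nerve C).obj n) : coprodSimplicesι T n f ≫ coprodSimplicesDesc T n p = p f :=
  Sigma.ι_desc _ _

@[simp]
lemma coprodSimplicesι_desc_assoc {C : Type v} [SmallCategory.{v} C] (T : (SimplexOver C)ᵒᵖ ⥤ A)
    (n : SimplexCategoryᵒᵖ) {X : A} (p : ∀ f : (nerve C).obj n, T.obj (op ⟨n.unop, f⟩) ⟶ X)
    (f : (nerve C).obj n) {Y : A} (h : X ⟶ Y) :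
    coprodSimplicesι T n f ≫ coprodSimplicesDesc T n p ≫ h = p f ≫ h := by
  rw [← Category.assoc, coprodSimplicesι_desc]

lemma coprodSimplices_hom_ext {C : Type v} [SmallCategory.{v} C] {T : (SimplexOver C)ᵒᵖ ⥤ A}
    {n : SimplexCategoryᵒᵖ} {X : A} {g h : coprodSimplices T n ⟶ X}
    (w : ∀ f, coprodSimplicesι T n f ≫ g = coprodSimplicesι T n f ≫ h) : g = h :=
  Sigma.hom_ext _ _ w

/-- The simplicial replacement `∐_* T` of a contravariant Thomason natural system
`T : (Δ/C)ᵒᵖ ⥤ A`: in degree `n` it is the coproduct of the `T(f)` over all `f : [n] ⥤ C`, and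
`σ : [m] ⟶ [n]` acts on the summand of `f` by `σ^* : T(f) ⟶ T(f ∘ σ)`. -/
def simplicialReplacementObj {C : Type v} [SmallCategory.{v} C] (T : (SimplexOver C)ᵒᵖ ⥤ A) :
    SimplicialObject A where
  obj n := coprodSimplices T n
  map {n m} σ := coprodSimplicesDesc T n fun f =>
    T.map (SimplexOver.ofHom σ.unop f).op ≫ coprodSimplicesι T m ((nerve C).map σ f)
  map_id n := coprodSimplices_hom_ext fun f => by
    rw [coprodSimplicesι_desc, Category.comp_id]
    exact (congrArg (· ≫ coprodSimplicesι T n f) (T.map_id _)).trans (Category.id_comp _)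
  map_comp {n m k} σ τ := coprodSimplices_hom_ext fun f => by
    rw [coprodSimplicesι_desc, coprodSimplicesι_desc_assoc, Category.assoc, coprodSimplicesι_desc,
      ← T.map_comp_assoc]
    rfl

/-- The component `τ_f : T(f) ⟶ T'(φ ∘ f)` of a natural transformation `τ : T ⟶ T' ∘ Δ/φ`. -/
def simplexComponent {C C' : Type v} [SmallCategory.{v} C] [SmallCategory.{v} C']
    (φ : C ⥤ C') {T : (SimplexOver C)ᵒᵖ ⥤ A} {T' : (SimplexOver C')ᵒᵖ ⥤ A}
    (τ : T ⟶ (SimplexOver.map φ).op ⋙ T') (n : SimplexCategoryᵒᵖ) (f : (nerve C).obj n) :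
    T.obj (op ⟨n.unop, f⟩) ⟶ T'.obj (op ⟨n.unop, (nerveMap φ).app n f⟩) :=
  τ.app (op ⟨n.unop, f⟩)

/-- The map of simplicial replacements induced by a functor `φ : C ⥤ C'` and a natural
transformation `τ : T ⟶ T' ∘ Δ/φ`: the summand of `f` goes to the summand of `φ ∘ f` by `τ_f`. -/
def simplicialReplacementMap {C C' : Type v} [SmallCategory.{v} C] [SmallCategory.{v} C']
    (φ : C ⥤ C') {T : (SimplexOver C)ᵒᵖ ⥤ A} {T' : (SimplexOver C')ᵒᵖ ⥤ A}
    (τ : T ⟶ (SimplexOver.map φ).op ⋙ T') :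
    simplicialReplacementObj T ⟶ simplicialReplacementObj T' where
  app n := coprodSimplicesDesc T n fun f =>
    simplexComponent φ τ n f ≫ coprodSimplicesι T' n ((nerveMap φ).app n f)
  naturality {n m} σ := coprodSimplices_hom_ext fun f => by
    simp only [simplicialReplacementObj]
    rw [coprodSimplicesι_desc_assoc, Category.assoc, coprodSimplicesι_desc,
      coprodSimplicesι_desc_assoc, Category.assoc, coprodSimplicesι_desc]
    exact (τ.naturality_assoc (SimplexOver.ofHom σ.unop f).op
      (coprodSimplicesι T' m ((nerveMap φ).app m ((nerve C).map σ f))))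

/-- The map of simplicial replacements induced by a morphism of Thomason natural systems on a
fixed category: on the summand of `f` it is `τ_f : T(f) ⟶ T'(f)`. -/
def simplicialReplacementHom {C : Type v} [SmallCategory.{v} C] {T T' : (SimplexOver C)ᵒᵖ ⥤ A}
    (τ : T ⟶ T') : simplicialReplacementObj T ⟶ simplicialReplacementObj T' where
  app n := coprodSimplicesDesc T n fun f => τ.app (op ⟨n.unop, f⟩) ≫ coprodSimplicesι T' n f
  naturality {n m} σ := coprodSimplices_hom_ext fun f => by simp [simplicialReplacementObj]

/-- The simplicial replacement as a functor of the Thomason natural system. -/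
def simplicialReplacement (A : Type u) [Category.{v} A] [HasColimits A]
    (C : Type v) [SmallCategory.{v} C] :
    ((SimplexOver C)ᵒᵖ ⥤ A) ⥤ SimplicialObject A where
  obj T := simplicialReplacementObj T
  map τ := simplicialReplacementHom τ
  map_id T := by
    ext n
    refine coprodSimplices_hom_ext fun f => (coprodSimplicesι_desc _ _ _ _).trans ?_
    exact (Category.id_comp _).trans (Category.comp_id _).symm
  map_comp {T T' T''} τ τ' := by
    ext n
    refine coprodSimplices_hom_ext fun f => (coprodSimplicesι_desc _ _ _ _).trans ?_
    refine Eq.trans ?_ (coprodSimplicesι_desc_assoc T n _ f _).symm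
    refine Eq.trans ?_ (Category.assoc _ _ _).symm
    refine Eq.trans ?_ (_ ≫= (coprodSimplicesι_desc T' n _ f).symm)
    exact Category.assoc _ _ _

/-- The Thomason chain complex `C_*^{Th}(C, T)`: in degree `n` it is `∐_{f : [n] ⥤ C} T(f)`, and the
differential is the alternating sum of the maps induced by the cofaces `δ^i`. -/
def thomasonComplex (A : Type u) [Category.{v} A] [Abelian A] [HasColimits A]
    (C : Type v) [SmallCategory.{v} C] : ((SimplexOver C)ᵒᵖ ⥤ A) ⥤ ChainComplex A ℕ :=
  simplicialReplacement A C ⋙ AlgebraicTopology.alternatingFaceMapComplex A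

/-- Thomason homology `H_n^{Th}(C, -)`. -/
def thomasonHomology (A : Type u) [Category.{v} A] [Abelian A] [HasColimits A]
    (C : Type v) [SmallCategory.{v} C] (n : ℕ) : ((SimplexOver C)ᵒᵖ ⥤ A) ⥤ A :=
  thomasonComplex A C ⋙ HomologicalComplex.homologyFunctor A _ n

/-- The map `H_n^{Th}(C, T) ⟶ H_n^{Th}(C', T')` induced by a functor `φ : C ⥤ C'` and a natural
transformation `τ : T ⟶ T' ∘ Δ/φ`. -/
def thomasonHomologyMap {A : Type u} [Category.{v} A] [Abelian A] [HasColimits A]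
    {C C' : Type v} [SmallCategory.{v} C] [SmallCategory.{v} C']
    (φ : C ⥤ C') {T : (SimplexOver C)ᵒᵖ ⥤ A} {T' : (SimplexOver C')ᵒᵖ ⥤ A}
    (τ : T ⟶ (SimplexOver.map φ).op ⋙ T') (n : ℕ) :
    (thomasonHomology A C n).obj T ⟶ (thomasonHomology A C' n).obj T' :=
  (HomologicalComplex.homologyFunctor A _ n).map
    ((AlgebraicTopology.alternatingFaceMapComplex A).map
      (X := simplicialReplacementObj T) (Y := simplicialReplacementObj T')
      (simplicialReplacementMap φ τ))

end Homology

/-! ### The symbolic tensor product -/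

section Tensor

variable {I : Type v} [SmallCategory.{v} I] {A : Type u} [Category.{v} A] [Abelian A]

/-- The functor `A ⥤ Fun(Iᵒᵖ, Ab)`, `X ↦ Hom_A(D(-), X)`. -/
def homFunctor (D : I ⥤ A) : A ⥤ (Iᵒᵖ ⥤ AddCommGrpCat.{v}) :=
  preadditiveYoneda ⋙ (Functor.whiskeringLeft _ _ _).obj D.op

instance (D : I ⥤ A) : (homFunctor D).Additive where
  map_add {X Y f g} := by
    ext i x
    exact Preadditive.comp_add _ _ _ x f g

variable [HasColimits A]

/-- The index set of the relations in the presentation of `F ⊗_I D` by the generators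
`x ⊗ D(i)`, `x ∈ F(i)`: compatibility with the morphisms of `I`, and additivity in `x`. -/
abbrev TensorRel (F : Iᵒᵖ ⥤ AddCommGrpCat.{v}) : Type v :=
  (Σ (i j : I) (_ : i ⟶ j), F.obj (op j)) ⊕ (Σ i : I, F.obj (op i) × F.obj (op i))

/-- The coproduct of the generators of `F ⊗_I D`. -/
abbrev tensorGen (F : Iᵒᵖ ⥤ AddCommGrpCat.{v}) (D : I ⥤ A) : A :=
  ∐ fun p : Σ i : I, F.obj (op i) => D.obj p.1

/-- The morphism out of the coproduct of the generators with given components. -/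
abbrev tensorGenDesc (F : Iᵒᵖ ⥤ AddCommGrpCat.{v}) (D : I ⥤ A) {X : A}
    (p : ∀ (i : I), F.obj (op i) → (D.obj i ⟶ X)) : tensorGen F D ⟶ X :=
  Sigma.desc fun q => p q.1 q.2

/-- The inclusion of the generator `x ⊗ D(i)`. -/
abbrev tensorGenι (F : Iᵒᵖ ⥤ AddCommGrpCat.{v}) (D : I ⥤ A) (i : I) (x : F.obj (op i)) :
    D.obj i ⟶ tensorGen F D :=
  Sigma.ι (fun p : Σ i : I, F.obj (op i) => D.obj p.1) ⟨i, x⟩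

/-- The object of `A` on which a relation lives. -/
abbrev tensorRelObj (F : Iᵒᵖ ⥤ AddCommGrpCat.{v}) (D : I ⥤ A) : TensorRel F → A
  | .inl r => D.obj r.1
  | .inr r => D.obj r.1

/-- The relations `F(u)(x) ⊗ a = x ⊗ D(u)(a)` and `(x + y) ⊗ a = x ⊗ a + y ⊗ a`. -/
def tensorRelMap (F : Iᵒᵖ ⥤ AddCommGrpCat.{v}) (D : I ⥤ A) :
    (∐ tensorRelObj F D) ⟶ tensorGen F D :=
  Sigma.desc fun
    | .inl ⟨i, j, t, x⟩ => tensorGenι F D i (F.map t.op x) - D.map t ≫ tensorGenι F D j x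
    | .inr ⟨i, x, y⟩ => tensorGenι F D i (x + y) - (tensorGenι F D i x + tensorGenι F D i y)

/-- The object `F ⊗_I D`. -/
abbrev tensorObj (D : I ⥤ A) (F : Iᵒᵖ ⥤ AddCommGrpCat.{v}) : A :=
  cokernel (tensorRelMap F D)

/-- The inclusion of the generator `x ⊗ D(i)` in `F ⊗_I D`. -/
def tensorι (D : I ⥤ A) (F : Iᵒᵖ ⥤ AddCommGrpCat.{v}) (i : I) (x : F.obj (op i)) :
    D.obj i ⟶ tensorObj D F :=
  tensorGenι F D i x ≫ cokernel.π _

lemma tensorι_map (D : I ⥤ A) (F : Iᵒᵖ ⥤ AddCommGrpCat.{v}) {i j : I} (t : i ⟶ j)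
    (x : F.obj (op j)) : tensorι D F i (F.map t.op x) = D.map t ≫ tensorι D F j x := by
  have h := Sigma.ι (tensorRelObj F D) (.inl ⟨i, j, t, x⟩) ≫= cokernel.condition (tensorRelMap F D)
  rw [comp_zero, tensorRelMap, Sigma.ι_desc_assoc, Preadditive.sub_comp, sub_eq_zero,
    Category.assoc] at h
  exact h

lemma tensorι_add (D : I ⥤ A) (F : Iᵒᵖ ⥤ AddCommGrpCat.{v}) (i : I)
    (x y : F.obj (op i)) : tensorι D F i (x + y) = tensorι D F i x + tensorι D F i y := by
  have h := Sigma.ι (tensorRelObj F D) (.inr ⟨i, x, y⟩) ≫= cokernel.condition (tensorRelMap F D)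
  rw [comp_zero, tensorRelMap, Sigma.ι_desc_assoc, Preadditive.sub_comp, sub_eq_zero,
    Preadditive.add_comp] at h
  exact h

/-- The morphism out of `F ⊗_I D` with given components. -/
def tensorDesc (D : I ⥤ A) (F : Iᵒᵖ ⥤ AddCommGrpCat.{v}) {X : A}
    (p : ∀ (i : I), F.obj (op i) → (D.obj i ⟶ X))
    (h₁ : ∀ (i j : I) (t : i ⟶ j) (x : F.obj (op j)), p i (F.map t.op x) = D.map t ≫ p j x)
    (h₂ : ∀ (i : I) (x y : F.obj (op i)), p i (x + y) = p i x + p i y) : tensorObj D F ⟶ X :=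
  cokernel.desc _ (tensorGenDesc F D p) (by
    refine Sigma.hom_ext _ _ ?_
    rintro (⟨i, j, t, x⟩ | ⟨i, x, y⟩)
    · rw [tensorRelMap, Sigma.ι_desc_assoc, comp_zero, Preadditive.sub_comp, sub_eq_zero,
        Category.assoc, Sigma.ι_desc, Sigma.ι_desc]
      exact h₁ i j t x
    · rw [tensorRelMap, Sigma.ι_desc_assoc, comp_zero, Preadditive.sub_comp, sub_eq_zero,
        Preadditive.add_comp, Sigma.ι_desc, Sigma.ι_desc, Sigma.ι_desc]
      exact h₂ i x y)

lemma tensorι_desc (D : I ⥤ A) (F : Iᵒᵖ ⥤ AddCommGrpCat.{v}) {X : A}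
    (p : ∀ (i : I), F.obj (op i) → (D.obj i ⟶ X)) (h₁ h₂) (i : I) (x : F.obj (op i)) :
    tensorι D F i x ≫ tensorDesc D F p h₁ h₂ = p i x := by
  rw [tensorι, tensorDesc, Category.assoc, cokernel.π_desc, Sigma.ι_desc]

lemma tensorObj_hom_ext {D : I ⥤ A} {F : Iᵒᵖ ⥤ AddCommGrpCat.{v}} {X : A}
    {f g : tensorObj D F ⟶ X} (h : ∀ i x, tensorι D F i x ≫ f = tensorι D F i x ≫ g) : f = g := by
  rw [← cancel_epi (cokernel.π (tensorRelMap F D))]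
  refine Sigma.hom_ext _ _ fun ⟨i, x⟩ => ?_
  exact (Category.assoc _ _ _).symm.trans ((h i x).trans (Category.assoc _ _ _))

/-- The bijection `Hom_A(F ⊗_I D, X) ≃ Hom(F, Hom_A(D(-), X))`. -/
def tensorHomEquiv (D : I ⥤ A) (F : Iᵒᵖ ⥤ AddCommGrpCat.{v}) (X : A) :
    (tensorObj D F ⟶ X) ≃ (F ⟶ (homFunctor D).obj X) where
  toFun f :=
    { app i := AddCommGrpCat.ofHom (AddMonoidHom.mk' (fun x => tensorι D F i.unop x ≫ f)
        fun x y => by rw [tensorι_add]; exact Preadditive.add_comp _ _ _ _ _ _)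
      naturality i j t := by
        ext x
        change tensorι D F j.unop (F.map t.unop.op x) ≫ f = D.map t.unop ≫ tensorι D F i.unop x ≫ f
        rw [tensorι_map, Category.assoc] }
  invFun α := tensorDesc D F (fun i x => (α.app (op i)).hom x)
    (fun i j t x => ConcreteCategory.congr_hom (α.naturality t.op) x)
    (fun i x y => (α.app (op i)).hom.map_add x y)
  left_inv f := tensorObj_hom_ext fun i x => tensorι_desc _ _ _ _ _ _ _
  right_inv α := by
    ext i x
    exact tensorι_desc D F (fun i x => (α.app (op i)).hom x) _ _ _ _

lemma tensorι_homEquiv_symm {D : I ⥤ A} {F : Iᵒᵖ ⥤ AddCommGrpCat.{v}} {X : A}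
    (α : F ⟶ (homFunctor D).obj X) (i : I) (x : F.obj (op i)) :
    tensorι D F i x ≫ (tensorHomEquiv D F X).symm α = (α.app (op i)).hom x := by
  apply tensorι_desc
  · exact fun i j t x => ConcreteCategory.congr_hom (α.naturality t.op) x
  · exact fun i x y => (α.app (op i)).hom.map_add x y

/-- The map `F ⊗_I D ⟶ G ⊗_I D` induced by `f : F ⟶ G`; it sends `x ⊗ a` to `f(x) ⊗ a`. -/
def tensorMapLeft (D : I ⥤ A) {F G : Iᵒᵖ ⥤ AddCommGrpCat.{v}} (f : F ⟶ G) :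
    tensorObj D F ⟶ tensorObj D G :=
  tensorDesc D F (fun i x => tensorι D G i (f.app (op i) x))
    (fun i j t x => by rw [← tensorι_map, ← NatTrans.naturality_apply])
    (fun i x y => by rw [map_add, tensorι_add])

lemma tensorι_mapLeft (D : I ⥤ A) {F G : Iᵒᵖ ⥤ AddCommGrpCat.{v}} (f : F ⟶ G)
    (i : I) (x : F.obj (op i)) :
    tensorι D F i x ≫ tensorMapLeft D f = tensorι D G i (f.app (op i) x) :=
  tensorι_desc _ _ _ _ _ _ _

lemma tensorι_mapLeft_assoc (D : I ⥤ A) {F G : Iᵒᵖ ⥤ AddCommGrpCat.{v}} (f : F ⟶ G)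
    (i : I) (x : F.obj (op i)) {X : A} (h : tensorObj D G ⟶ X) :
    tensorι D F i x ≫ tensorMapLeft D f ≫ h = tensorι D G i (f.app (op i) x) ≫ h := by
  rw [← Category.assoc, tensorι_mapLeft]

/-- The map `F ⊗_I D ⟶ F ⊗_I E` induced by `τ : D ⟶ E`; it sends `x ⊗ a` to `x ⊗ τ(a)`. -/
def tensorMapRight {D E : I ⥤ A} (τ : D ⟶ E) (F : Iᵒᵖ ⥤ AddCommGrpCat.{v}) :
    tensorObj D F ⟶ tensorObj E F :=
  tensorDesc D F (fun i x => τ.app i ≫ tensorι E F i x)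
    (fun i j t x => by rw [tensorι_map, τ.naturality_assoc])
    (fun i x y => by rw [tensorι_add, Preadditive.comp_add])

lemma tensorι_mapRight {D E : I ⥤ A} (τ : D ⟶ E) (F : Iᵒᵖ ⥤ AddCommGrpCat.{v})
    (i : I) (x : F.obj (op i)) :
    tensorι D F i x ≫ tensorMapRight τ F = τ.app i ≫ tensorι E F i x :=
  tensorι_desc _ _ _ _ _ _ _

lemma tensorι_mapRight_assoc {D E : I ⥤ A} (τ : D ⟶ E) (F : Iᵒᵖ ⥤ AddCommGrpCat.{v})
    (i : I) (x : F.obj (op i)) {X : A} (h : tensorObj E F ⟶ X) :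
    tensorι D F i x ≫ tensorMapRight τ F ≫ h = τ.app i ≫ tensorι E F i x ≫ h := by
  rw [← Category.assoc, tensorι_mapRight, Category.assoc]

/-- The symbolic tensor product `- ⊗_I D : Fun(Iᵒᵖ, Ab) ⥤ A`. -/
def symbolicTensor (D : I ⥤ A) : (Iᵒᵖ ⥤ AddCommGrpCat.{v}) ⥤ A where
  obj F := tensorObj D F
  map f := tensorMapLeft D f
  map_id F := tensorObj_hom_ext fun i x => by
    rw [tensorι_mapLeft, Category.comp_id]
    rfl
  map_comp f g := tensorObj_hom_ext fun i x => by
    rw [tensorι_mapLeft, tensorι_mapLeft_assoc, tensorι_mapLeft]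
    rfl

/-- The symbolic tensor product `- ⊗_I D` is left adjoint to `X ↦ Hom_A(D(-), X)`. -/
def symbolicTensorAdj (D : I ⥤ A) : symbolicTensor D ⊣ homFunctor D :=
  Adjunction.mkOfHomEquiv
    { homEquiv := tensorHomEquiv D
      homEquiv_naturality_left_symm {F G X} f g := tensorObj_hom_ext fun i x => by
        refine (tensorι_homEquiv_symm (f ≫ g) i x).trans ?_
        refine Eq.trans ?_ (tensorι_mapLeft_assoc D f i x _).symm
        exact (tensorι_homEquiv_symm g i (f.app (op i) x)).symm
      homEquiv_naturality_right {F X Y} f g := by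
        ext i x
        exact (Category.assoc _ _ _).symm }

instance (D : I ⥤ A) : (symbolicTensor D).Additive :=
  (symbolicTensorAdj D).left_adjoint_additive

/-- The natural transformation `- ⊗_I D ⟶ - ⊗_I E` induced by `τ : D ⟶ E`. -/
def symbolicTensorHom {D E : I ⥤ A} (τ : D ⟶ E) : symbolicTensor D ⟶ symbolicTensor E where
  app F := tensorMapRight τ F
  naturality {F G} f := tensorObj_hom_ext fun i x => by
    change tensorι D F i x ≫ tensorMapLeft D f ≫ tensorMapRight τ G =
      tensorι D F i x ≫ tensorMapRight τ F ≫ tensorMapLeft E f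
    rw [tensorι_mapLeft_assoc, tensorι_mapRight, tensorι_mapRight_assoc, tensorι_mapLeft]

lemma symbolicTensorHom_id (D : I ⥤ A) : symbolicTensorHom (𝟙 D) = 𝟙 (symbolicTensor D) := by
  ext F
  refine tensorObj_hom_ext fun i x => (tensorι_mapRight _ _ _ _).trans ?_
  exact (Category.id_comp _).trans (Category.comp_id _).symm

lemma symbolicTensorHom_comp {D E E' : I ⥤ A} (τ : D ⟶ E) (τ' : E ⟶ E') :
    symbolicTensorHom (τ ≫ τ') = symbolicTensorHom τ ≫ symbolicTensorHom τ' := by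
  ext F
  refine tensorObj_hom_ext fun i x => (tensorι_mapRight _ _ _ _).trans ?_
  change _ = tensorι D F i x ≫ tensorMapRight τ F ≫ tensorMapRight τ' F
  rw [tensorι_mapRight_assoc, tensorι_mapRight, NatTrans.comp_app, Category.assoc]

/-- The restriction functor `Fun(Kᵒᵖ, Ab) ⥤ Fun(Iᵒᵖ, Ab)` along `w : I ⥤ K`. -/
abbrev restrictAb {K : Type v} [SmallCategory.{v} K] (w : I ⥤ K) :
    (Kᵒᵖ ⥤ AddCommGrpCat.{v}) ⥤ (Iᵒᵖ ⥤ AddCommGrpCat.{v}) :=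
  (Functor.whiskeringLeft _ _ _).obj w.op

/-- The map `(F ∘ w) ⊗_I D ⟶ F ⊗_K E` induced by `w : I ⥤ K` and `τ : D ⟶ E ∘ w`;
it sends `x ⊗ a` to `x ⊗ τ(a)`. -/
def tensorChange {K : Type v} [SmallCategory.{v} K] (w : I ⥤ K) {D : I ⥤ A} {E : K ⥤ A}
    (τ : D ⟶ w ⋙ E) (F : Kᵒᵖ ⥤ AddCommGrpCat.{v}) :
    tensorObj D (w.op ⋙ F) ⟶ tensorObj E F :=
  tensorDesc D (w.op ⋙ F) (fun i x => τ.app i ≫ tensorι E F (w.obj i) x)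
    (fun _ j t x => (_ ≫= tensorι_map E F (w.map t) x).trans
      (τ.naturality_assoc t (tensorι E F (w.obj j) x)).symm)
    (fun i x y => (_ ≫= tensorι_add E F (w.obj i) x y).trans (Preadditive.comp_add _ _ _ _ _ _))

lemma tensorι_change {K : Type v} [SmallCategory.{v} K] (w : I ⥤ K) {D : I ⥤ A} {E : K ⥤ A}
    (τ : D ⟶ w ⋙ E) (F : Kᵒᵖ ⥤ AddCommGrpCat.{v}) (i : I) (x : F.obj (op (w.obj i))) :
    tensorι D (w.op ⋙ F) i x ≫ tensorChange w τ F = τ.app i ≫ tensorι E F (w.obj i) x :=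
  tensorι_desc _ _ _ _ _ _ _

lemma tensorι_change_assoc {K : Type v} [SmallCategory.{v} K] (w : I ⥤ K) {D : I ⥤ A} {E : K ⥤ A}
    (τ : D ⟶ w ⋙ E) (F : Kᵒᵖ ⥤ AddCommGrpCat.{v}) (i : I) (x : F.obj (op (w.obj i)))
    {X : A} (h : tensorObj E F ⟶ X) :
    tensorι D (w.op ⋙ F) i x ≫ tensorChange w τ F ≫ h = τ.app i ≫ tensorι E F (w.obj i) x ≫ h := by
  rw [← Category.assoc, tensorι_change, Category.assoc]

/-- The natural transformation `(- ∘ w) ⊗_I D ⟶ - ⊗_K E` induced by `w : I ⥤ K` and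
`τ : D ⟶ E ∘ w`. -/
def symbolicTensorChange {K : Type v} [SmallCategory.{v} K] (w : I ⥤ K) {D : I ⥤ A} {E : K ⥤ A}
    (τ : D ⟶ w ⋙ E) : restrictAb w ⋙ symbolicTensor D ⟶ symbolicTensor E where
  app F := tensorChange w τ F
  naturality {F G} f := tensorObj_hom_ext fun i x => by
    refine (tensorι_mapLeft_assoc D ((restrictAb w).map f) i x (tensorChange w τ G)).trans ?_
    refine (tensorι_change w τ G i _).trans ?_
    refine Eq.trans ?_ (tensorι_change_assoc w τ F i x (tensorMapLeft E f)).symm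
    exact _ ≫= (tensorι_mapLeft E f (w.obj i) x).symm

end Tensor

/-! ### Projective resolutions in categories of diagrams of abelian groups -/

section Projectives

variable {J : Type v} [SmallCategory.{v} J]

/-- The functor `ℤ Hom_J(j, -)`. -/
abbrev freeRep (j : J) : J ⥤ AddCommGrpCat.{v} := coyoneda.obj (op j) ⋙ AddCommGrpCat.free

/-- Morphisms from `ℤ Hom_J(j, -)` to `F` are the elements of `F(j)`. -/
def freeRepEquiv (j : J) (F : J ⥤ AddCommGrpCat.{v}) : (freeRep j ⟶ F) ≃ F.obj j :=
  ((AddCommGrpCat.adj.whiskerRight J).homEquiv (coyoneda.obj (op j)) F).trans coyonedaEquiv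

lemma freeRepEquiv_comp (j : J) {F G : J ⥤ AddCommGrpCat.{v}} (f : freeRep j ⟶ F) (g : F ⟶ G) :
    freeRepEquiv j G (f ≫ g) = g.app j (freeRepEquiv j F f) := by
  simp only [freeRepEquiv, Equiv.trans_apply]
  erw [Adjunction.homEquiv_naturality_right]
  rfl

lemma freeRepEquiv_apply (j : J) {F : J ⥤ AddCommGrpCat.{v}} (f : freeRep j ⟶ F) :
    ∃ a : (freeRep j).obj j, f.app j a = freeRepEquiv j F f :=
  ⟨freeRepEquiv j _ (𝟙 _), by rw [← freeRepEquiv_comp, Category.id_comp]⟩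

instance (j : J) : Projective (freeRep j) where
  factors {F G} f e he := by
    have : Epi (e.app j) := inferInstance
    obtain ⟨y, hy⟩ := (AddCommGrpCat.epi_iff_surjective _).1 this (freeRepEquiv j _ f)
    refine ⟨(freeRepEquiv j _).symm y, (freeRepEquiv j _).injective ?_⟩
    rw [freeRepEquiv_comp, Equiv.apply_symm_apply, hy]

instance : EnoughProjectives (J ⥤ AddCommGrpCat.{v}) where
  presentation F := ⟨{
    p := ∐ fun q : Σ j : J, F.obj j => freeRep q.1
    projective := inferInstance
    f := Sigma.desc fun q => (freeRepEquiv q.1 F).symm q.2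
    epi := by
      refine @NatTrans.epi_of_epi_app _ _ _ _ _ _ _ fun j => ?_
      rw [AddCommGrpCat.epi_iff_surjective]
      intro y
      obtain ⟨a, ha⟩ := freeRepEquiv_apply j ((freeRepEquiv j F).symm y)
      refine ⟨(Sigma.ι (fun q : Σ j : J, F.obj j => freeRep q.1) ⟨j, y⟩).app j a, ?_⟩
      rw [Equiv.apply_symm_apply] at ha
      rw [← ConcreteCategory.comp_apply, ← NatTrans.comp_app, Sigma.ι_desc]
      exact ha }⟩

end Projectives

/-! ### Tor -/

section Tor

variable {A : Type u} [Category.{v} A] [Abelian A] [HasColimits A]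
variable {I : Type v} [SmallCategory.{v} I]

/-- `Tor_n^I(-, D)`, the `n`-th left derived functor of `- ⊗_I D : Fun(Iᵒᵖ, Ab) ⥤ A`. -/
def Tor (D : I ⥤ A) (n : ℕ) : (Iᵒᵖ ⥤ AddCommGrpCat.{v}) ⥤ A :=
  (symbolicTensor D).leftDerived n

/-- The constant functor `ℤ : Iᵒᵖ ⥤ Ab`. -/
def constZ (I : Type v) [SmallCategory.{v} I] : Iᵒᵖ ⥤ AddCommGrpCat.{v} :=
  (Functor.const _).obj (AddCommGrpCat.of (ULift.{v} ℤ))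

/-- The functor `Tor_n^I(ℤ, -) : Fun(I, A) ⥤ A`. -/
def torZ (A : Type u) [Category.{v} A] [Abelian A] [HasColimits A] (I : Type v)
    [SmallCategory.{v} I] (n : ℕ) : (I ⥤ A) ⥤ A where
  obj D := (Tor D n).obj (constZ I)
  map τ := (NatTrans.leftDerived (symbolicTensorHom τ) n).app (constZ I)
  map_id D := by
    rw [symbolicTensorHom_id, NatTrans.leftDerived_id]
    rfl
  map_comp τ τ' := by
    rw [symbolicTensorHom_comp, NatTrans.leftDerived_comp]
    rfl

end Tor

/-! ### Maps between left derived functors along an exact functor -/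

section DerivedChange

universe v₁ v₂ v₃ u₁ u₂ u₃

variable {B : Type u₁} [Category.{v₁} B] [Abelian B] {B' : Type u₂} [Category.{v₂} B'] [Abelian B']
  {A : Type u₃} [Category.{v₃} A] [Abelian A]

/-- The comparison lemma: a morphism lifts to a chain map from an augmented complex of projective
objects to an exact augmented complex. -/
lemma exists_chain_lift {K L : ChainComplex B ℕ} (hK : ∀ n, Projective (K.X n)) {Y W : B}
    (p : K.X 0 ⟶ Y) (hp : K.d 1 0 ≫ p = 0) (q : L.X 0 ⟶ W) (hq : L.d 1 0 ≫ q = 0) (_ : Epi q)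
    (h₀ : (ShortComplex.mk _ _ hq).Exact)
    (hs : ∀ n, (ShortComplex.mk _ _ (L.d_comp_d (n + 2) (n + 1) n)).Exact) (f : Y ⟶ W) :
    ∃ l : K ⟶ L, l.f 0 ≫ q = p ≫ f := by
  obtain ⟨l0, h_l0⟩ : ∃ l0 : K.X 0 ⟶ L.X 0, l0 ≫ q = p ≫ f :=
    ⟨Projective.factorThru (p ≫ f) q, Projective.factorThru_comp _ _⟩
  have e0 : (K.d 1 0 ≫ l0) ≫ q = 0 := by
    rw [Category.assoc, h_l0, reassoc_of% hp, zero_comp]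
  have es : ∀ (n : ℕ) (g : K.X n ⟶ L.X n) (g' : K.X (n + 1) ⟶ L.X (n + 1))
      (_ : g' ≫ L.d (n + 1) n = K.d (n + 1) n ≫ g),
      (K.d (n + 2) (n + 1) ≫ g') ≫ L.d (n + 1) n = 0 := by
    intro n g g' h
    rw [Category.assoc, h, K.d_comp_d_assoc, zero_comp]
  refine ⟨ChainComplex.mkHom _ _ l0 (h₀.liftFromProjective (K.d 1 0 ≫ l0) e0)
    (h₀.liftFromProjective_comp _ e0) (fun n r =>
      ⟨(hs n).liftFromProjective (K.d (n + 2) (n + 1) ≫ r.2.1) (es n _ _ r.2.2),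
        (hs n).liftFromProjective_comp _ (es n _ _ r.2.2)⟩), ?_⟩
  rw [ChainComplex.mkHom_f_0, h_l0]

/-- A morphism `f : Y ⟶ R(Z)` lifts to a chain map `P ⟶ R(Q)`, where `P` and `Q` are projective
resolutions of `Y` and `Z` and `R` is an exact functor. -/
lemma exists_resolution_lift (R : B' ⥤ B) [R.Additive] [PreservesFiniteLimits R]
    [PreservesFiniteColimits R] {Y : B} {Z : B'} (P : ProjectiveResolution Y)
    (Q : ProjectiveResolution Z) (f : Y ⟶ R.obj Z) :
    ∃ l : P.complex ⟶ (R.mapHomologicalComplex _).obj Q.complex,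
      l.f 0 ≫ R.map (Q.π.f 0) = P.π.f 0 ≫ f :=
  have _ : Epi (Q.π.f 0) := inferInstance
  exists_chain_lift (L := (R.mapHomologicalComplex _).obj Q.complex) P.projective (P.π.f 0)
    P.complex_d_comp_π_f_zero (R.map (Q.π.f 0)) _ (R.map_epi (Q.π.f 0)) (Q.exact₀.map R)
    (fun n => (Q.exact_succ n).map R) f

variable [EnoughProjectives B] [EnoughProjectives B']

/-- The chain map `F(R(K)) ⟶ F'(K)` induced by `α : F ∘ R ⟶ F'`. -/
def complexChange {R : B' ⥤ B} [R.Additive] {F : B ⥤ A} [F.Additive] {F' : B' ⥤ A} [F'.Additive]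
    (α : R ⋙ F ⟶ F') (K : ChainComplex B' ℕ) :
    (F.mapHomologicalComplex _).obj ((R.mapHomologicalComplex _).obj K) ⟶
      (F'.mapHomologicalComplex _).obj K where
  f n := α.app (K.X n)
  comm' i j _ := (α.naturality (K.d i j)).symm

/-- Let `R` be an exact functor, `α : F ∘ R ⟶ F'` a natural transformation between additive
functors, and `f : Y ⟶ R(Z)` a morphism. This is the induced map `(L_n F)(Y) ⟶ (L_n F')(Z)`,
computed by a chain map `P ⟶ R(Q)` lifting `f` between projective resolutions of `Y` and `Z`. -/
def leftDerivedChange {R : B' ⥤ B} [R.Additive] [PreservesFiniteLimits R]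
    [PreservesFiniteColimits R] {F : B ⥤ A} [F.Additive] {F' : B' ⥤ A} [F'.Additive]
    (α : R ⋙ F ⟶ F') {Y : B} {Z : B'} (f : Y ⟶ R.obj Z) (n : ℕ) :
    (F.leftDerived n).obj Y ⟶ (F'.leftDerived n).obj Z :=
  ((projectiveResolution Y).isoLeftDerivedObj F n).hom ≫
    (HomologicalComplex.homologyFunctor A _ n).map
      ((F.mapHomologicalComplex _).map (exists_resolution_lift R (projectiveResolution Y)
          (projectiveResolution Z) f).choose ≫
        complexChange α (projectiveResolution Z).complex) ≫
    ((projectiveResolution Z).isoLeftDerivedObj F' n).inv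

end DerivedChange

/-- The map `Tor_n^I(ℤ, D) ⟶ Tor_n^K(ℤ, E)` induced by a functor `w : I ⥤ K` and a natural
transformation `τ : D ⟶ E ∘ w`. -/
def torZMap {A : Type u} [Category.{v} A] [Abelian A] [HasColimits A]
    {I K : Type v} [SmallCategory.{v} I] [SmallCategory.{v} K] (w : I ⥤ K) {D : I ⥤ A} {E : K ⥤ A}
    (τ : D ⟶ w ⋙ E) (n : ℕ) : (torZ A I n).obj D ⟶ (torZ A K n).obj E :=
  leftDerivedChange (symbolicTensorChange w τ) (Y := constZ I) (Z := constZ K)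
    { app _ := 𝟙 _ } n

/-! ### Homological δ-functors and left derived functors -/

section DeltaFunctor

universe v₁ v₂ v₃ u₁ u₂ u₃

/-- A homological `δ`-functor `(T_n)_{n ≥ 0}` between abelian categories: additive functors `T_n`
and natural connecting morphisms which turn each short exact sequence
`0 ⟶ X₁ ⟶ X₂ ⟶ X₃ ⟶ 0` into a long exact sequence
`⋯ ⟶ T_{n+1}(X₃) ⟶ T_n(X₁) ⟶ T_n(X₂) ⟶ T_n(X₃) ⟶ ⋯ ⟶ T_0(X₃) ⟶ 0`. -/
structure HomologicalDeltaFunctor (B : Type u₁) [Category.{v₁} B] [Abelian B]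
    (A : Type u₂) [Category.{v₂} A] [Abelian A] where
  /-- the functors `T_n` -/
  functor : ℕ → B ⥤ A
  additive (n : ℕ) : (functor n).Additive
  /-- the connecting morphism `T_{n+1}(X₃) ⟶ T_n(X₁)` -/
  δ (S : ShortComplex B) (hS : S.ShortExact) (n : ℕ) :
    (functor (n + 1)).obj S.X₃ ⟶ (functor n).obj S.X₁
  δ_naturality {S S' : ShortComplex B} (hS : S.ShortExact) (hS' : S'.ShortExact) (f : S ⟶ S')
    (n : ℕ) : δ S hS n ≫ (functor n).map f.τ₁ = (functor (n + 1)).map f.τ₃ ≫ δ S' hS' n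
  δ_comp (S : ShortComplex B) (hS : S.ShortExact) (n : ℕ) : δ S hS n ≫ (functor n).map S.f = 0
  map_comp_map (S : ShortComplex B) (_ : S.ShortExact) (n : ℕ) :
    (functor n).map S.f ≫ (functor n).map S.g = 0
  comp_δ (S : ShortComplex B) (hS : S.ShortExact) (n : ℕ) :
    (functor (n + 1)).map S.g ≫ δ S hS n = 0
  exact₁ (S : ShortComplex B) (hS : S.ShortExact) (n : ℕ) :
    (ShortComplex.mk _ _ (δ_comp S hS n)).Exact
  exact₂ (S : ShortComplex B) (hS : S.ShortExact) (n : ℕ) :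
    (ShortComplex.mk _ _ (map_comp_map S hS n)).Exact
  exact₃ (S : ShortComplex B) (hS : S.ShortExact) (n : ℕ) :
    (ShortComplex.mk _ _ (comp_δ S hS n)).Exact
  epi_zero (S : ShortComplex B) (hS : S.ShortExact) : Epi ((functor 0).map S.g)

namespace HomologicalDeltaFunctor

variable {B : Type u₁} [Category.{v₁} B] [Abelian B] {A : Type u₂} [Category.{v₂} A] [Abelian A]
  {B' : Type u₃} [Category.{v₃} B'] [Abelian B']

/-- A morphism of homological `δ`-functors: natural transformations `G_n ⟶ T_n` which commute with
the connecting morphisms. -/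
@[ext]
structure Hom (G T : HomologicalDeltaFunctor B A) where
  /-- the natural transformation in degree `n` -/
  app (n : ℕ) : G.functor n ⟶ T.functor n
  comm (S : ShortComplex B) (hS : S.ShortExact) (n : ℕ) :
    G.δ S hS n ≫ (app n).app S.X₁ = (app (n + 1)).app S.X₃ ≫ T.δ S hS n

/-- A homological `δ`-functor `T` is universal if each natural transformation `G_0 ⟶ T_0` from a
homological `δ`-functor `G` extends uniquely to a morphism of `δ`-functors `G ⟶ T`. -/
def IsUniversal (T : HomologicalDeltaFunctor B A) : Prop :=
  ∀ (G : HomologicalDeltaFunctor B A) (η : G.functor 0 ⟶ T.functor 0),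
    ∃! h : Hom G T, h.app 0 = η

/-- The composition of a homological `δ`-functor with an exact functor. -/
def precomp (T : HomologicalDeltaFunctor B A) (R : B' ⥤ B) [R.Additive] [PreservesFiniteLimits R]
    [PreservesFiniteColimits R] : HomologicalDeltaFunctor B' A where
  functor n := R ⋙ T.functor n
  additive n := by have := T.additive n; infer_instance
  δ S hS n := T.δ (S.map R) (hS.map_of_exact R) n
  δ_naturality hS hS' f n :=
    T.δ_naturality (hS.map_of_exact R) (hS'.map_of_exact R) (R.mapShortComplex.map f) n
  δ_comp S hS n := T.δ_comp (S.map R) (hS.map_of_exact R) n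
  map_comp_map S hS n := T.map_comp_map (S.map R) (hS.map_of_exact R) n
  comp_δ S hS n := T.comp_δ (S.map R) (hS.map_of_exact R) n
  exact₁ S hS n := T.exact₁ (S.map R) (hS.map_of_exact R) n
  exact₂ S hS n := T.exact₂ (S.map R) (hS.map_of_exact R) n
  exact₃ S hS n := T.exact₃ (S.map R) (hS.map_of_exact R) n
  epi_zero S hS := T.epi_zero (S.map R) (hS.map_of_exact R)

end HomologicalDeltaFunctor

/-- The left derived functors of a functor `F` between abelian categories: a universal homological
`δ`-functor `(L_n F)_{n ≥ 0}` together with an isomorphism `L_0 F ≅ F`. -/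
structure LeftDerivedFunctors {B : Type u₁} [Category.{v₁} B] [Abelian B]
    {A : Type u₂} [Category.{v₂} A] [Abelian A] (F : B ⥤ A) extends
    HomologicalDeltaFunctor B A where
  /-- the isomorphism `L_0 F ≅ F` -/
  zeroIso : functor 0 ≅ F
  universal : toHomologicalDeltaFunctor.IsUniversal

end DeltaFunctor

/-! ### Derived colimits -/

section DerivedColimit

variable {A : Type u} [Category.{v} A] [Abelian A] [HasColimits A]

/-- A choice of the derived colimit functors `colim_n^I : Fun(I, A) ⥤ A`, the left derived functors
of `colim^I`. -/
abbrev DerivedColimits (A : Type u) [Category.{v} A] [Abelian A] [HasColimits A]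
    (I : Type v) [SmallCategory.{v} I] :=
  LeftDerivedFunctors (colim : (I ⥤ A) ⥤ A)

/-- The canonical map `colim^I (E ∘ w) ⟶ colim^K E`. -/
def colimChange {I K : Type v} [SmallCategory.{v} I] [SmallCategory.{v} K] (w : I ⥤ K) :
    (Functor.whiskeringLeft I K A).obj w ⋙ colim ⟶ (colim : (K ⥤ A) ⥤ A) where
  app E := colimit.pre E w
  naturality {E E'} f := by
    refine colimit.hom_ext fun i => ?_
    simp

/-- The canonical map `colim_n^I (E ∘ w) ⟶ colim_n^K E`: the unique morphism of `δ`-functors which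
is the canonical map of colimits in degree `0`. -/
def derivedColimChange {I K : Type v} [SmallCategory.{v} I] [SmallCategory.{v} K] (w : I ⥤ K)
    (L : DerivedColimits A I) (M : DerivedColimits A K) :
    (L.precomp ((Functor.whiskeringLeft I K A).obj w)).Hom M.toHomologicalDeltaFunctor :=
  (M.universal (L.precomp ((Functor.whiskeringLeft I K A).obj w))
    (Functor.whiskerLeft _ L.zeroIso.hom ≫ colimChange w ≫ M.zeroIso.inv)).choose

/-- The map `colim_n^I D ⟶ colim_n^K E` induced by a functor `w : I ⥤ K` and a natural
transformation `τ : D ⟶ E ∘ w`. -/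
def derivedColimMap {I K : Type v} [SmallCategory.{v} I] [SmallCategory.{v} K]
    (L : DerivedColimits A I) (M : DerivedColimits A K) (w : I ⥤ K) {D : I ⥤ A} {E : K ⥤ A}
    (τ : D ⟶ w ⋙ E) (n : ℕ) : (L.functor n).obj D ⟶ (M.functor n).obj E :=
  (L.functor n).map τ ≫ ((derivedColimChange w L M).app n).app E

end DerivedColimit

end Thomason

end

open Thomason

/-! The Thomason complex is compared with each of the other two theories separately.

For Tor, let `P_n` be the functor ℤ Hom_Δ([n], dim -) on Δ/C (`simplexRep`). A map σ : [n] ⟶ dim x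
determines the n-simplex obtained by restricting x along σ, so `P_n` is a direct sum of free
representable functors, one for each f : [n] ⥤ C. Hence it is projective, and `P_n` ⊗ T is the
coproduct of the T(f). At an object x, `P_*` is the free simplicial abelian group on a standard
simplex, which contracts onto ℤ. So `P_*` resolves the constant functor ℤ (`simplexResolution`), and
`P_*` ⊗ T is the Thomason complex of T (`thomasonComplexIsoTensor`). This half does not need
coproducts to be exact.

For the derived colimits, exactness of coproducts makes T ↦ (Thomason complex of T) exact, so
Thomason homology is a homological δ-functor (`thomasonDelta`). In degree 0 it is the colimit,
because the differential from degree 1 glues the two ends of each edge and all vertices of a simplex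
are joined by edges. It is universal because every T receives a functorial epimorphism from its
decalage, the coproduct of the T(f') over all f' that extend f by a new first vertex. The complex of
the decalage has an extra degeneracy, hence no homology in positive degrees, and a coeffaceable
δ-functor is universal (`isUniversal_of_coeffaceable`). This also proves that the derived colimits
exist; any other choice is canonically isomorphic to this one.

Naturality in C holds on the Tor side because `P_*` depends on the dimension of a simplex only:
restricting the resolution along Δ/φ gives back the resolution, and induced maps between derived
functors may be computed from any resolutions and any lift (`leftDerivedChange_eq`). On the side of
colimits, morphisms into a universal δ-functor are determined in degree 0, where they are compared
by hand. -/

noncomputable section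

namespace Thomason

/-! ### Independence of induced maps from resolutions and lifts -/

section DerivedChangeComputation

universe v₁ v₂ v₃ u₁ u₂ u₃

variable {B : Type u₁} [Category.{v₁} B] [Abelian B] {B' : Type u₂} [Category.{v₂} B'] [Abelian B']
  {A : Type u₃} [Category.{v₃} A] [Abelian A]

/-- A chain map from a complex of projective objects to a complex which is exact in positive degrees
is null homotopic if it vanishes after composition with an exact augmentation. -/
lemma nonempty_homotopy_zero {K L : ChainComplex B ℕ} (hK : ∀ n, Projective (K.X n)) {W : B}
    (q : L.X 0 ⟶ W) (hq : L.d 1 0 ≫ q = 0) (h₀ : (ShortComplex.mk _ _ hq).Exact)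
    (hs : ∀ n, (ShortComplex.mk _ _ (L.d_comp_d (n + 2) (n + 1) n)).Exact) (f : K ⟶ L)
    (hf : f.f 0 ≫ q = 0) : Nonempty (Homotopy f 0) := by
  -- Each new component of the homotopy lifts the part of `f` not yet accounted for; `e₁` and `e₂`
  -- say that this part consists of cycles, so exactness and projectivity provide the lift.
  have e₁ : (f.f 1 - K.d 1 0 ≫ h₀.liftFromProjective (f.f 0) hf) ≫ L.d 1 0 = 0 := by
    rw [Preadditive.sub_comp, Category.assoc, h₀.liftFromProjective_comp, f.comm, sub_self]
  have e₂ : ∀ (n : ℕ) (g : K.X n ⟶ L.X (n + 1)) (g' : K.X (n + 1) ⟶ L.X (n + 2))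
      (_ : f.f (n + 1) = K.d (n + 1) n ≫ g + g' ≫ L.d (n + 2) (n + 1)),
      (f.f (n + 2) - K.d (n + 2) (n + 1) ≫ g') ≫ L.d (n + 2) (n + 1) = 0 := by
    intro n g g' h
    rw [Preadditive.sub_comp, Category.assoc, f.comm, h, Preadditive.comp_add,
      K.d_comp_d_assoc, zero_comp, zero_add, sub_self]
  exact ⟨Homotopy.mkInductive _ (h₀.liftFromProjective (f.f 0) hf)
    (h₀.liftFromProjective_comp _ hf).symm
    ((hs 0).liftFromProjective _ e₁)
    (by rw [(hs 0).liftFromProjective_comp _ e₁, add_sub_cancel])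
    (fun n r => ⟨(hs (n + 1)).liftFromProjective _ (e₂ n _ _ r.2.2), by
      rw [(hs (n + 1)).liftFromProjective_comp _ (e₂ n _ _ r.2.2), add_sub_cancel]⟩)⟩

variable [EnoughProjectives B] [EnoughProjectives B']

/-- Any two lifts of `f` become homotopic once the resolutions are compared by chain maps over the
identities, because an exact `R` keeps the second resolution exact. The lemma allows the induced map
to be computed with an explicit resolution. -/
lemma leftDerivedChange_eq {R : B' ⥤ B} [R.Additive] [PreservesFiniteLimits R]
    [PreservesFiniteColimits R] {F : B ⥤ A} [F.Additive] {F' : B' ⥤ A} [F'.Additive]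
    (α : R ⋙ F ⟶ F') {Y : B} {Z : B'} (f : Y ⟶ R.obj Z) (n : ℕ) (P : ProjectiveResolution Y)
    (Q : ProjectiveResolution Z) (l : P.complex ⟶ (R.mapHomologicalComplex _).obj Q.complex)
    (hl : l.f 0 ≫ R.map (Q.π.f 0) = P.π.f 0 ≫ f) :
    leftDerivedChange α f n = (P.isoLeftDerivedObj F n).hom ≫
      (HomologicalComplex.homologyFunctor A _ n).map
        ((F.mapHomologicalComplex _).map l ≫ complexChange α Q.complex) ≫
      (Q.isoLeftDerivedObj F' n).inv := by
  let a := ProjectiveResolution.lift (𝟙 Y) (projectiveResolution Y) P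
  let b := ProjectiveResolution.lift (𝟙 Z) Q (projectiveResolution Z)
  have ha : a.f 0 ≫ P.π.f 0 = (projectiveResolution Y).π.f 0 ≫ 𝟙 Y :=
    ProjectiveResolution.lift_commutes_zero _ _ _
  have hb : b.f 0 ≫ (projectiveResolution Z).π.f 0 = Q.π.f 0 ≫ 𝟙 Z :=
    ProjectiveResolution.lift_commutes_zero _ _ _
  have ha₀ : a.f 0 ≫ P.π.f 0 = (projectiveResolution Y).π.f 0 := ha.trans (Category.comp_id _)
  have hb₀ : b.f 0 ≫ (projectiveResolution Z).π.f 0 = Q.π.f 0 := hb.trans (Category.comp_id _)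
  have h₁ := ProjectiveResolution.isoLeftDerivedObj_hom_naturality (𝟙 Y)
    (projectiveResolution Y) P a ha F n
  have h₂ := ProjectiveResolution.isoLeftDerivedObj_inv_naturality (𝟙 Z)
    Q (projectiveResolution Z) b hb F' n
  rw [CategoryTheory.Functor.map_id, Category.id_comp] at h₁
  rw [CategoryTheory.Functor.map_id, Category.comp_id] at h₂
  have hc := (exists_resolution_lift R (projectiveResolution Y)
    (projectiveResolution Z) f).choose_spec
  rw [leftDerivedChange, h₁, h₂, Functor.comp_map, Functor.comp_map, Category.assoc]
  rw [← Functor.map_comp_assoc, ← Functor.map_comp_assoc]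
  generalize (exists_resolution_lift R (projectiveResolution Y)
    (projectiveResolution Z) f).choose = c at hc
  have _ : Epi ((projectiveResolution Z).π.f 0) := inferInstance
  -- The chosen lift `c` is compared with the detour through `P` and `Q`. Both cover `f`, so their
  -- difference vanishes on the augmentation.
  obtain ⟨H⟩ := nonempty_homotopy_zero
    (L := (R.mapHomologicalComplex _).obj (projectiveResolution Z).complex)
    (projectiveResolution Y).projective (R.map ((projectiveResolution Z).π.f 0)) _
    ((projectiveResolution Z).exact₀.map R) (fun n => ((projectiveResolution Z).exact_succ n).map R)
    (c - a ≫ l ≫ (R.mapHomologicalComplex _).map b) (by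
      refine (Preadditive.sub_comp _ _ _).trans (sub_eq_zero.2 (hc.trans ?_))
      have h₃ (l₀ : P.complex.X 0 ⟶ R.obj (Q.complex.X 0))
          (hl₀ : l₀ ≫ R.map (Q.π.f 0) = P.π.f 0 ≫ f) :
          (a.f 0 ≫ l₀ ≫ R.map (b.f 0)) ≫ R.map ((projectiveResolution Z).π.f 0) =
            (projectiveResolution Y).π.f 0 ≫ f := by
        rw [Category.assoc, Category.assoc, ← R.map_comp, hb₀, hl₀]
        exact (Category.assoc _ _ _).symm.trans (ha₀ =≫ f)
      exact (h₃ (l.f 0) hl).symm)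
  have e := (F.mapHomotopy (Homotopy.equivSubZero.symm H)).homologyMap_eq n
  -- Naturality of `α` moves the comparison `b` from the source side to the target side.
  have e' : (F.mapHomologicalComplex _).map ((R.mapHomologicalComplex _).map b) ≫
      complexChange α (projectiveResolution Z).complex =
      complexChange α Q.complex ≫ (F'.mapHomologicalComplex _).map b := by
    ext i
    exact α.naturality (b.f i)
  have e₂ : (F.mapHomologicalComplex _).map
      (a ≫ l ≫ (R.mapHomologicalComplex (ComplexShape.down ℕ)).map b) ≫
        complexChange α (projectiveResolution Z).complex =
      ((F.mapHomologicalComplex _).map a ≫ (F.mapHomologicalComplex _).map l ≫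
        complexChange α Q.complex) ≫ (F'.mapHomologicalComplex _).map b := by
    rw [Functor.map_comp, Functor.map_comp, Category.assoc, Category.assoc, e',
      Category.assoc, Category.assoc]
  have e₃ : (HomologicalComplex.homologyFunctor A _ n).map ((F.mapHomologicalComplex _).map c) =
    (HomologicalComplex.homologyFunctor A _ n).map ((F.mapHomologicalComplex _).map
      (a ≫ l ≫ (R.mapHomologicalComplex (ComplexShape.down ℕ)).map b)) := e
  congr 2
  refine ((HomologicalComplex.homologyFunctor A _ n).map_comp _ _).trans ?_
  rw [e₃, ← Functor.map_comp, e₂]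

end DerivedChangeComputation

/-! ### Coeffaceable δ-functors are universal -/

namespace HomologicalDeltaFunctor

universe v₁ v₂ u₁ u₂

variable {B : Type u₁} [Category.{v₁} B] [Abelian B] {A : Type u₂} [Category.{v₂} A] [Abelian A]

/-- The short complex `0 ⟶ ker p ⟶ X ⟶ Y ⟶ 0`. -/
abbrev kernelSequence {X Y : B} (p : X ⟶ Y) : ShortComplex B :=
  ShortComplex.mk (kernel.ι p) p (kernel.condition p)

lemma kernelSequence_shortExact {X Y : B} (p : X ⟶ Y) [Epi p] : (kernelSequence p).ShortExact where
  exact := ShortComplex.exact_kernel p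
  mono_f := inferInstanceAs (Mono (kernel.ι p))
  epi_g := inferInstanceAs (Epi p)

/-- The morphism of kernel sequences with given components on the middle and right objects. -/
def kernelSequenceMap {X Y : B} (p : X ⟶ Y) {S : ShortComplex B} (hS : S.ShortExact)
    (f : X ⟶ S.X₂) (g : Y ⟶ S.X₃) (w : f ≫ S.g = p ≫ g) : kernelSequence p ⟶ S :=
  have := hS.mono_f
  { τ₁ := hS.exact.lift (kernel.ι p ≫ f) (by
      rw [Category.assoc, w, kernel.condition_assoc, zero_comp])
    τ₂ := f
    τ₃ := g
    comm₁₂ := hS.exact.lift_f _ _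
    comm₂₃ := w }

section Lift

variable (G T : HomologicalDeltaFunctor B A) {n : ℕ} (α : G.functor n ⟶ T.functor n)
  {S : ShortComplex B} (hS : S.ShortExact)

lemma mono_δ (h : IsZero ((T.functor (n + 1)).obj S.X₂)) : Mono (T.δ S hS n) :=
  (T.exact₃ S hS n).mono_g (h.eq_of_src _ _)

variable (h : IsZero ((T.functor (n + 1)).obj S.X₂))

/-- If `T_{n+1}(X₂) = 0`, a natural transformation `G_n ⟶ T_n` induces
`G_{n+1}(X₃) ⟶ T_{n+1}(X₃)`. -/
def liftSucc : (G.functor (n + 1)).obj S.X₃ ⟶ (T.functor (n + 1)).obj S.X₃ :=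
  have := T.mono_δ hS h
  -- As `δ` is monic and the long sequence is exact, `δ` is the kernel of T_n(X₁) ⟶ T_n(X₂).
  -- Naturality of `α` moves the vanishing condition to `G`, where consecutive maps compose to zero.
  (T.exact₁ S hS n).lift (G.δ S hS n ≫ α.app S.X₁) (by
    rw [Category.assoc, ← α.naturality, ← Category.assoc, G.δ_comp, zero_comp])

lemma liftSucc_δ : liftSucc G T α hS h ≫ T.δ S hS n = G.δ S hS n ≫ α.app S.X₁ :=
  have := T.mono_δ hS h
  (T.exact₁ S hS n).lift_f _ _

/-- The connecting morphism of `S'` is monic, so both sides may be compared after it; there they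
reduce to naturality of the two connecting morphisms and of `α`. -/
lemma liftSucc_naturality {S' : ShortComplex B} (hS' : S'.ShortExact)
    (h' : IsZero ((T.functor (n + 1)).obj S'.X₂)) (f : S ⟶ S') :
    (G.functor (n + 1)).map f.τ₃ ≫ liftSucc G T α hS' h' =
      liftSucc G T α hS h ≫ (T.functor (n + 1)).map f.τ₃ := by
  have := T.mono_δ hS' h'
  rw [← cancel_mono (T.δ S' hS' n), Category.assoc, liftSucc_δ, Category.assoc,
    ← T.δ_naturality hS hS', ← Category.assoc, ← G.δ_naturality hS hS', ← Category.assoc,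
    liftSucc_δ, Category.assoc, Category.assoc, α.naturality]

end Lift

section Universal

variable (T : HomologicalDeltaFunctor B A) {E : B ⥤ B} (ε : E ⟶ 𝟭 B) [∀ X, Epi (ε.app X)]
  (hE : ∀ (n : ℕ) (X : B), IsZero ((T.functor (n + 1)).obj (E.obj X)))
  (G : HomologicalDeltaFunctor B A)

lemma ε_shortExact (X : B) : (kernelSequence (ε.app X)).ShortExact :=
  kernelSequence_shortExact _

/-- The extension of a natural transformation `G_n ⟶ T_n` to degree `n + 1`, if the functors
`T_{n+1}` vanish on the objects `E(X)`. -/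
def extendSucc (n : ℕ) (α : G.functor n ⟶ T.functor n) :
    G.functor (n + 1) ⟶ T.functor (n + 1) where
  app X := liftSucc G T α (ε_shortExact ε X) (hE n X)
  -- Here `E` must be a functor and `ε` natural: `f` then extends to a morphism between the two
  -- kernel sequences.
  naturality {X Y} f := liftSucc_naturality G T α (ε_shortExact ε X) (hE n X)
    (ε_shortExact ε Y) (hE n Y)
    (kernelSequenceMap (ε.app X) (ε_shortExact ε Y) (E.map f) f (ε.naturality f))

/-- The extension is defined through the kernel sequence of `ε` at X₃, which need not map to a given
sequence S. Both receive a map from the kernel sequence of the epimorphism E(X₂) ⟶ X₂ ⟶ X₃, with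
identity on X₃. Its middle term E(X₂) is again acyclic, so the lift can be computed there. -/
lemma extendSucc_comm (n : ℕ) (α : G.functor n ⟶ T.functor n) (S : ShortComplex B)
    (hS : S.ShortExact) :
    G.δ S hS n ≫ α.app S.X₁ = (extendSucc T ε hE G n α).app S.X₃ ≫ T.δ S hS n := by
  have := hS.epi_g
  have hQ := kernelSequence_shortExact (ε.app S.X₂ ≫ S.g)
  let a : kernelSequence (ε.app S.X₂ ≫ S.g) ⟶ S :=
    kernelSequenceMap _ hS (ε.app S.X₂) (𝟙 _) (Category.comp_id _).symm
  let b : kernelSequence (ε.app S.X₂ ≫ S.g) ⟶ kernelSequence (ε.app S.X₃) :=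
    kernelSequenceMap _ (ε_shortExact ε S.X₃) (E.map S.g) (𝟙 _)
      ((ε.naturality S.g).trans (Category.comp_id _).symm)
  have hb := liftSucc_naturality G T α hQ (hE n S.X₂) (ε_shortExact ε S.X₃) (hE n S.X₃) b
  have hb' : liftSucc G T α (ε_shortExact ε S.X₃) (hE n S.X₃) =
      liftSucc G T α hQ (hE n S.X₂) := by
    change (G.functor (n + 1)).map (𝟙 S.X₃) ≫ _ = _ ≫ (T.functor (n + 1)).map (𝟙 S.X₃) at hb
    rw [CategoryTheory.Functor.map_id, CategoryTheory.Functor.map_id] at hb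
    exact (Category.id_comp _).symm.trans (hb.trans (Category.comp_id _))
  have hG := G.δ_naturality hQ hS a n
  have hT := T.δ_naturality hQ hS a n
  have hG' : G.δ S hS n = G.δ _ hQ n ≫ (G.functor n).map a.τ₁ := by
    rw [hG]
    change _ = (G.functor (n + 1)).map (𝟙 S.X₃) ≫ _
    rw [CategoryTheory.Functor.map_id]
    exact (Category.id_comp _).symm
  have hT' : T.δ S hS n = T.δ _ hQ n ≫ (T.functor n).map a.τ₁ := by
    rw [hT]
    change _ = (T.functor (n + 1)).map (𝟙 S.X₃) ≫ _
    rw [CategoryTheory.Functor.map_id]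
    exact (Category.id_comp _).symm
  change _ = liftSucc G T α (ε_shortExact ε S.X₃) (hE n S.X₃) ≫ _
  rw [hb', hG', hT', Category.assoc, α.naturality, ← Category.assoc, ← Category.assoc, liftSucc_δ]

/-- Compatibility with the kernel sequence of `ε` at X alone determines `β` at X, since the
connecting morphism of `T` there is monic. -/
lemma eq_extendSucc (n : ℕ) (α : G.functor n ⟶ T.functor n)
    (β : G.functor (n + 1) ⟶ T.functor (n + 1))
    (hβ : ∀ (S : ShortComplex B) (hS : S.ShortExact),
      G.δ S hS n ≫ α.app S.X₁ = β.app S.X₃ ≫ T.δ S hS n) : β = extendSucc T ε hE G n α := by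
  ext X
  have := T.mono_δ (ε_shortExact ε X) (hE n X)
  rw [← cancel_mono (T.δ _ (ε_shortExact ε X) n)]
  exact (hβ _ (ε_shortExact ε X)).symm.trans (extendSucc_comm T ε hE G n α _ _)

/-- A coeffaceable homological `δ`-functor is universal. -/
theorem isUniversal_of_coeffaceable (T : HomologicalDeltaFunctor B A) {E : B ⥤ B} (ε : E ⟶ 𝟭 B)
    [∀ X, Epi (ε.app X)]
    (hE : ∀ (n : ℕ) (X : B), IsZero ((T.functor (n + 1)).obj (E.obj X))) : T.IsUniversal := fun G η => by
  let a (n : ℕ) : G.functor n ⟶ T.functor n :=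
    Nat.rec η (fun n α => extendSucc T ε hE G n α) n
  refine ⟨⟨a, fun S hS n => extendSucc_comm T ε hE G n (a n) S hS⟩, rfl, fun g hg => ?_⟩
  have hga (n : ℕ) : g.app n = a n := by
    induction n with
    | zero => exact hg
    | succ n ih =>
      refine eq_extendSucc T ε hE G n (a n) _ fun S hS => ?_
      rw [← ih]
      exact g.comm S hS n
  exact Hom.ext (funext hga)

end Universal

end HomologicalDeltaFunctor

/-! ### δ-functors from exact functors to chain complexes -/

section DeltaFunctorOfComplexes

universe v₁ v₂ v₃ u₁ u₂ u₃

variable {B : Type u₁} [Category.{v₁} B] [Abelian B] {A : Type u₂} [Category.{v₂} A] [Abelian A]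
  {B' : Type u₃} [Category.{v₃} B'] [Abelian B']

/-- In degree 0 all chains are cycles, so homology is the quotient `opcycles` of the degree 0 term.
This gives the right end of the long exact sequence. -/
lemma epi_homologyMap_zero {K L : ChainComplex A ℕ} (f : K ⟶ L) [Epi (f.f 0)] :
    Epi (HomologicalComplex.homologyMap f 0) := by
  have h₁ : Epi (HomologicalComplex.opcyclesMap f 0) := by
    have : Epi (K.pOpcycles 0 ≫ HomologicalComplex.opcyclesMap f 0) := by
      rw [HomologicalComplex.p_opcyclesMap]
      infer_instance
    exact epi_of_epi (K.pOpcycles 0) _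
  have h₂ : HomologicalComplex.homologyMap f 0 =
      K.homologyι 0 ≫ HomologicalComplex.opcyclesMap f 0 ≫ inv (L.homologyι 0) := by
    rw [← Category.assoc, ← HomologicalComplex.homologyι_naturality, Category.assoc,
      IsIso.hom_inv_id, Category.comp_id]
  rw [h₂]
  infer_instance

/-- The homology of an exact functor to chain complexes is a homological `δ`-functor. -/
def HomologicalDeltaFunctor.ofComplexes (K : B ⥤ ChainComplex A ℕ) [K.Additive]
    (hK : ∀ S : ShortComplex B, S.ShortExact → (S.map K).ShortExact) :
    HomologicalDeltaFunctor B A where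
  functor n := K ⋙ HomologicalComplex.homologyFunctor A _ n
  additive _ := inferInstance
  δ S hS n := (hK S hS).δ (n + 1) n rfl
  δ_naturality hS hS' f n :=
    HomologicalComplex.HomologySequence.δ_naturality (K.mapShortComplex.map f) (hK _ hS) (hK _ hS')
      (n + 1) n rfl
  δ_comp S hS n := (hK S hS).δ_comp (n + 1) n rfl
  map_comp_map S hS n := by
    rw [← Functor.map_comp, S.zero]
    exact Functor.map_zero _ _ _
  comp_δ S hS n := (hK S hS).comp_δ (n + 1) n rfl
  exact₁ S hS n := (hK S hS).homology_exact₁ (n + 1) n rfl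
  exact₂ S hS n := (hK S hS).homology_exact₂ n
  exact₃ S hS n := (hK S hS).homology_exact₃ (n + 1) n rfl
  epi_zero S hS := by
    have : Epi (K.map S.g) := (hK S hS).epi_g
    have : Epi ((K.map S.g).f 0) := inferInstance
    exact epi_homologyMap_zero _

/-- A natural transformation between exact functors to chain complexes induces a morphism of
`δ`-functors. -/
def HomologicalDeltaFunctor.homOfComplexes {K : B ⥤ ChainComplex A ℕ} [K.Additive]
    (hK : ∀ S : ShortComplex B, S.ShortExact → (S.map K).ShortExact)
    {K' : B' ⥤ ChainComplex A ℕ} [K'.Additive]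
    (hK' : ∀ S : ShortComplex B', S.ShortExact → (S.map K').ShortExact)
    (R : B' ⥤ B) [R.Additive] [PreservesFiniteLimits R] [PreservesFiniteColimits R]
    (α : R ⋙ K ⟶ K') :
    ((HomologicalDeltaFunctor.ofComplexes K hK).precomp R).Hom
      (HomologicalDeltaFunctor.ofComplexes K' hK') where
  app n := { app T := HomologicalComplex.homologyMap (α.app T) n
             naturality {T T'} f := by
              refine (HomologicalComplex.homologyMap_comp _ _ _).symm.trans ?_
              refine Eq.trans ?_ (HomologicalComplex.homologyMap_comp _ _ _)
              exact congrArg (HomologicalComplex.homologyMap · n) (α.naturality f) }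
  comm S hS n :=
    HomologicalComplex.HomologySequence.δ_naturality
      (S₁ := (S.map R).map K) (S₂ := S.map K')
      { τ₁ := α.app S.X₁, τ₂ := α.app S.X₂, τ₃ := α.app S.X₃,
        comm₁₂ := (α.naturality S.f).symm, comm₂₃ := (α.naturality S.g).symm }
      (hK _ (hS.map_of_exact R)) (hK' _ hS) (n + 1) n rfl

end DeltaFunctorOfComplexes

/-! ### Thomason homology as a δ-functor -/

section ThomasonDelta

variable (A : Type u) [Category.{v} A] [Abelian A] [HasColimits A]
  (C : Type v) [SmallCategory.{v} C]

/-- The functor `T ↦ ∐_f T(f)`, where `f` runs through the `n`-simplices of the nerve. -/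
abbrev coprodSimplicesFunctor (n : SimplexCategoryᵒᵖ) : ((SimplexOver C)ᵒᵖ ⥤ A) ⥤ A :=
  simplicialReplacement A C ⋙ (evaluation _ _).obj n

variable {C} in
/-- The `n`-simplices of the nerve of `C` as a discrete subcategory of `(Δ/C)ᵒᵖ`. -/
abbrev simplicesInclusion (n : SimplexCategoryᵒᵖ) :
    Discrete ((nerve C).obj n) ⥤ (SimplexOver C)ᵒᵖ :=
  Discrete.functor fun f => op ⟨n.unop, f⟩

variable {A C} in
/-- The diagram of the coproduct of the `T(f)`. -/
def simplicesInclusionCompIso (n : SimplexCategoryᵒᵖ) (T : (SimplexOver C)ᵒᵖ ⥤ A) :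
    Discrete.functor (fun f : (nerve C).obj n => T.obj (op ⟨n.unop, f⟩)) ≅
      simplicesInclusion n ⋙ T :=
  Discrete.natIso fun _ => Iso.refl _

/-- The coproduct over the `n`-simplices is a colimit over a discrete category. -/
def coprodSimplicesIso (n : SimplexCategoryᵒᵖ) :
    coprodSimplicesFunctor A C n ≅
      (Functor.whiskeringLeft _ _ A).obj (simplicesInclusion n) ⋙ colim :=
  NatIso.ofComponents (fun T => HasColimit.isoOfNatIso (simplicesInclusionCompIso n T))
    (fun {T T'} τ => coprodSimplices_hom_ext fun f => by
      refine (coprodSimplicesι_desc_assoc T n _ f _).trans ?_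
      refine (Category.assoc _ _ _).trans ?_
      refine (_ ≫= HasColimit.isoOfNatIso_ι_hom (simplicesInclusionCompIso n T') ⟨f⟩).trans ?_
      refine Eq.trans ?_
        (HasColimit.isoOfNatIso_ι_hom_assoc (simplicesInclusionCompIso n T) ⟨f⟩ _).symm
      refine (_ ≫= Category.id_comp _).trans ?_
      refine Eq.trans ?_ (Category.id_comp _).symm
      exact (ι_colimMap (Functor.whiskerLeft (simplicesInclusion n) τ) ⟨f⟩).symm)

instance (n : SimplexCategoryᵒᵖ) : (coprodSimplicesFunctor A C n).Additive where
  map_add {T T' τ τ'} := coprodSimplices_hom_ext fun f => by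
    refine (coprodSimplicesι_desc T n _ f).trans ?_
    refine Eq.trans ?_ (Preadditive.comp_add _ _ _ _ _ _).symm
    refine Eq.trans ?_ (congrArg₂ (· + ·) (coprodSimplicesι_desc T n _ f).symm
      (coprodSimplicesι_desc T n _ f).symm)
    exact Preadditive.add_comp _ _ _ _ _ _

instance : (thomasonComplex A C).Additive where
  map_add {T T' τ τ'} := by
    ext n
    exact (coprodSimplicesFunctor A C (op (.mk n))).map_add

variable [AB4 A]

/-- This is where exactness of coproducts enters: restriction of diagrams is exact, and by `AB4` so
is the colimit over a discrete category. -/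
instance (n : SimplexCategoryᵒᵖ) : PreservesFiniteLimits (coprodSimplicesFunctor A C n) :=
  preservesFiniteLimits_of_natIso (coprodSimplicesIso A C n).symm

instance (n : SimplexCategoryᵒᵖ) : PreservesFiniteColimits (coprodSimplicesFunctor A C n) :=
  preservesFiniteColimits_of_natIso (coprodSimplicesIso A C n).symm

variable {A C} in
lemma thomasonComplex_shortExact (S : ShortComplex ((SimplexOver C)ᵒᵖ ⥤ A)) (hS : S.ShortExact) :
    (S.map (thomasonComplex A C)).ShortExact :=
  HomologicalComplex.shortExact_of_degreewise_shortExact _ fun n =>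
    hS.map_of_exact (coprodSimplicesFunctor A C (op (.mk n)))

/-- Thomason homology as a homological `δ`-functor. -/
def thomasonDelta : HomologicalDeltaFunctor ((SimplexOver C)ᵒᵖ ⥤ A) A :=
  HomologicalDeltaFunctor.ofComplexes (thomasonComplex A C) thomasonComplex_shortExact

variable {C}

/-- The map of Thomason complexes induced by a functor `φ : C ⥤ C'`, as a natural transformation. -/
def thomasonComplexChange {C' : Type v} [SmallCategory.{v} C'] (φ : C ⥤ C') :
    (Functor.whiskeringLeft _ _ A).obj (SimplexOver.map φ).op ⋙ thomasonComplex A C ⟶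
      thomasonComplex A C' where
  app T' := (AlgebraicTopology.alternatingFaceMapComplex A).map
    (X := simplicialReplacementObj ((SimplexOver.map φ).op ⋙ T'))
    (Y := simplicialReplacementObj T') (simplicialReplacementMap φ (𝟙 _))
  naturality {T T'} τ := by
    ext n
    refine coprodSimplices_hom_ext fun f => ?_
    refine (coprodSimplicesι_desc_assoc ((SimplexOver.map φ).op ⋙ T) _ _ f _).trans ?_
    refine Eq.trans ?_ (coprodSimplicesι_desc_assoc ((SimplexOver.map φ).op ⋙ T) _ _ f _).symm
    refine (Category.assoc _ _ _).trans ?_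
    refine Eq.trans ?_ (Category.assoc _ _ _).symm
    refine (_ ≫= coprodSimplicesι_desc ((SimplexOver.map φ).op ⋙ T') _ _ f).trans ?_
    refine Eq.trans ?_ (_ ≫= (coprodSimplicesι_desc T _ _ _).symm)
    refine (_ ≫= Category.id_comp _).trans ?_
    exact (Category.id_comp _).symm

/-- The morphism of `δ`-functors on Thomason homology induced by a functor `φ : C ⥤ C'`. -/
def thomasonDeltaChange {C' : Type v} [SmallCategory.{v} C'] (φ : C ⥤ C') :
    ((thomasonDelta A C).precomp
      ((Functor.whiskeringLeft _ _ A).obj (SimplexOver.map φ).op)).Hom (thomasonDelta A C') :=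
  HomologicalDeltaFunctor.homOfComplexes _ _ _ (thomasonComplexChange A φ)

variable {A}

/-- The pair (φ, τ) factors as τ over the identity of `C` followed by φ with the identity
transformation; the second factor is a morphism of δ-functors, to which universality applies. -/
lemma thomasonHomologyMap_eq {C' : Type v} [SmallCategory.{v} C'] (φ : C ⥤ C')
    {T : (SimplexOver C)ᵒᵖ ⥤ A} {T' : (SimplexOver C')ᵒᵖ ⥤ A}
    (τ : T ⟶ (SimplexOver.map φ).op ⋙ T') (n : ℕ) :
    thomasonHomologyMap φ τ n =
      (thomasonHomology A C n).map τ ≫ ((thomasonDeltaChange A φ).app n).app T' := by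
  refine Eq.trans ?_ (HomologicalComplex.homologyMap_comp _ _ _)
  refine congrArg (HomologicalComplex.homologyMap · n) ?_
  ext k
  refine coprodSimplices_hom_ext fun f => ?_
  refine (coprodSimplicesι_desc T _ _ f).trans ?_
  refine Eq.trans ?_ (coprodSimplicesι_desc_assoc T _ _ f _).symm
  refine Eq.trans ?_ (Category.assoc _ _ _).symm
  refine Eq.trans ?_ (_ ≫= (coprodSimplicesι_desc ((SimplexOver.map φ).op ⋙ T') _ _ f).symm)
  exact _ ≫= (Category.id_comp _).symm

end ThomasonDelta

/-! ### Homology in degree zero as a quotient -/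

section HomologyZero

universe v₁ u₁

variable {A : Type u₁} [Category.{v₁} A] [Abelian A]

/-- The projection from degree `0` to the homology in degree `0` of a chain complex. -/
def toHomologyZero (K : ChainComplex A ℕ) : K.X 0 ⟶ K.homology 0 :=
  K.pOpcycles 0 ≫ K.isoHomologyι₀.inv

instance (K : ChainComplex A ℕ) : Epi (toHomologyZero K) := by
  unfold toHomologyZero
  infer_instance

lemma toHomologyZero_naturality {K L : ChainComplex A ℕ} (f : K ⟶ L) :
    toHomologyZero K ≫ HomologicalComplex.homologyMap f 0 = f.f 0 ≫ toHomologyZero L := by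
  rw [toHomologyZero, Category.assoc, ChainComplex.isoHomologyι₀_inv_naturality,
    HomologicalComplex.p_opcyclesMap_assoc, toHomologyZero]

lemma d_toHomologyZero (K : ChainComplex A ℕ) : K.d 1 0 ≫ toHomologyZero K = 0 := by
  rw [toHomologyZero, HomologicalComplex.d_pOpcycles_assoc, zero_comp]

/-- The morphism out of the homology in degree `0` induced by a morphism which vanishes on
boundaries. -/
def homologyZeroDesc (K : ChainComplex A ℕ) {X : A} (k : K.X 0 ⟶ X) (hk : K.d 1 0 ≫ k = 0) :
    K.homology 0 ⟶ X :=
  K.isoHomologyι₀.hom ≫ K.descOpcycles k 1 (by simp) hk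

lemma toHomologyZero_desc (K : ChainComplex A ℕ) {X : A} (k : K.X 0 ⟶ X)
    (hk : K.d 1 0 ≫ k = 0) : toHomologyZero K ≫ homologyZeroDesc K k hk = k := by
  rw [toHomologyZero, homologyZeroDesc, Category.assoc, Iso.inv_hom_id_assoc,
    HomologicalComplex.p_descOpcycles]

end HomologyZero

/-! ### Thomason homology in degree zero is the colimit -/

section ThomasonZero

open scoped Simplicial

lemma coprodSimplicesι_δ {A : Type u} [Category.{v} A] [HasColimits A]
    {C : Type v} [SmallCategory.{v} C] (T : (SimplexOver C)ᵒᵖ ⥤ A) {n : ℕ} (i : Fin (n + 2))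
    (f : (nerve C).obj (op ⦋n + 1⦌)) :
    coprodSimplicesι T (op ⦋n + 1⦌) f ≫ (simplicialReplacementObj T).δ i =
      T.map (SimplexOver.ofHom (SimplexCategory.δ i) f).op ≫
        coprodSimplicesι T (op ⦋n⦌) ((nerve C).map (SimplexCategory.δ i).op f) :=
  coprodSimplicesι_desc T _ _ _

variable {A : Type u} [Category.{v} A] [Abelian A] [HasColimits A]
  {C : Type v} [SmallCategory.{v} C]

/-- The projection `∐_c T(c) ⟶ H_0(C, T)`. -/
def verticesToHomology (T : (SimplexOver C)ᵒᵖ ⥤ A) :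
    coprodSimplices T (op ⦋0⦌) ⟶ (thomasonHomology A C 0).obj T :=
  toHomologyZero ((thomasonComplex A C).obj T)

instance (T : (SimplexOver C)ᵒᵖ ⥤ A) : Epi (verticesToHomology T) :=
  inferInstanceAs (Epi (toHomologyZero ((thomasonComplex A C).obj T)))

/-- The map `T(f) ⟶ H_0(C, T)` given by a vertex of `f`. -/
def vertexToHomology (T : (SimplexOver C)ᵒᵖ ⥤ A) {n : SimplexCategory} (w : ⦋0⦌ ⟶ n)
    (f : (nerve C).obj (op n)) : T.obj (op ⟨n, f⟩) ⟶ (thomasonHomology A C 0).obj T :=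
  T.map (SimplexOver.ofHom w f).op ≫
    coprodSimplicesι T (op ⦋0⦌) ((nerve C).map w.op f) ≫ verticesToHomology T

lemma map_vertexToHomology (T : (SimplexOver C)ᵒᵖ ⥤ A) {m n : SimplexCategory} (w : ⦋0⦌ ⟶ m)
    (σ : m ⟶ n) (f : (nerve C).obj (op n)) :
    T.map (SimplexOver.ofHom σ f).op ≫ vertexToHomology T w ((nerve C).map σ.op f) =
      vertexToHomology T (w ≫ σ) f := by
  unfold vertexToHomology
  rw [← T.map_comp_assoc]
  rfl

lemma thomasonComplex_d_one_zero (T : (SimplexOver C)ᵒᵖ ⥤ A) :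
    ((thomasonComplex A C).obj T).d 1 0 =
      (simplicialReplacementObj T).δ 0 - (simplicialReplacementObj T).δ 1 := by
  refine (AlgebraicTopology.AlternatingFaceMapComplex.obj_d_eq
    (simplicialReplacementObj T) 0).trans ?_
  rw [Fin.sum_univ_two]
  simp only [Fin.val_zero, pow_zero, one_smul, Fin.val_one, pow_one, neg_smul]
  exact (sub_eq_add_neg _ _).symm

lemma δ_verticesToHomology (T : (SimplexOver C)ᵒᵖ ⥤ A) :
    (simplicialReplacementObj T).δ (0 : Fin 2) ≫ verticesToHomology T =
      (simplicialReplacementObj T).δ 1 ≫ verticesToHomology T := by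
  have h := d_toHomologyZero ((thomasonComplex A C).obj T)
  rw [thomasonComplex_d_one_zero] at h
  exact sub_eq_zero.1 ((Preadditive.sub_comp _ _ _).symm.trans h)

/-- The differential from degree 1 is the difference of the two face maps, so its vanishing in
homology identifies the two ends of an edge. -/
lemma vertexToHomology_δ (T : (SimplexOver C)ᵒᵖ ⥤ A) (f : (nerve C).obj (op ⦋1⦌)) :
    vertexToHomology T (SimplexCategory.δ 0) f = vertexToHomology T (SimplexCategory.δ 1) f := by
  have e (i : Fin 2) : vertexToHomology T (SimplexCategory.δ i) f =
      coprodSimplicesι T (op ⦋1⦌) f ≫ (simplicialReplacementObj T).δ i ≫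
        verticesToHomology T := by
    refine Eq.trans ?_ (Category.assoc _ _ _)
    rw [coprodSimplicesι_δ]
    exact (Category.assoc _ _ _).symm
  rw [e, e]
  exact _ ≫= δ_verticesToHomology T

/-- Every vertex of a simplex is joined to its first vertex by an edge of that simplex. Independence
of the vertex is what makes these maps a cocone. -/
lemma vertexToHomology_eq (T : (SimplexOver C)ᵒᵖ ⥤ A) {n : SimplexCategory} (w : ⦋0⦌ ⟶ n)
    (f : (nerve C).obj (op n)) :
    vertexToHomology T w f = vertexToHomology T (SimplexCategory.const ⦋0⦌ n 0) f := by
  induction n with | _ n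
  let e : ⦋1⦌ ⟶ ⦋n⦌ := SimplexCategory.mkOfLe 0 (w.toOrderHom 0) (Fin.zero_le _)
  -- The coface `δ 0` misses 0 and so picks the end `w` of the edge; `δ 1` picks its start 0.
  have h₀ : w = SimplexCategory.δ 0 ≫ e := by
    ext i
    fin_cases i
    rfl
  have h₁ : SimplexCategory.const ⦋0⦌ ⦋n⦌ 0 = SimplexCategory.δ 1 ≫ e := by
    ext i
    fin_cases i
    rfl
  rw [h₁, ← map_vertexToHomology]
  conv_lhs => rw [h₀, ← map_vertexToHomology]
  rw [vertexToHomology_δ]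

/-- The cocone over `T` with point `H_0(C, T)`. -/
def vertexCocone (T : (SimplexOver C)ᵒᵖ ⥤ A) : Cocone T where
  pt := (thomasonHomology A C 0).obj T
  ι :=
    { app x := vertexToHomology T (SimplexCategory.const ⦋0⦌ x.unop.dim 0) x.unop.diagram
      naturality := by
        rintro ⟨⟨n, f⟩⟩ ⟨⟨m, g⟩⟩ ⟨⟨σ, hσ⟩⟩
        change m ⟶ n at σ
        change (nerve C).map σ.op f = g at hσ
        subst hσ
        -- The first vertex of the restricted simplex is the vertex σ(0) of `f`, which gives the
        -- same map as vertex 0.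
        refine Eq.trans ?_ (Category.comp_id _).symm
        exact (map_vertexToHomology T _ σ f).trans (vertexToHomology_eq T _ f) }

/-- The map `∐_{c} T(c) ⟶ colim T`. -/
def verticesToColimit (T : (SimplexOver C)ᵒᵖ ⥤ A) : coprodSimplices T (op ⦋0⦌) ⟶ colimit T :=
  coprodSimplicesDesc T _ fun f => colimit.ι T (op ⟨⦋0⦌, f⟩)

/-- Both faces of an edge, followed by the colimit legs at its ends, give the leg at the edge
itself. -/
lemma d_verticesToColimit (T : (SimplexOver C)ᵒᵖ ⥤ A) :
    ((thomasonComplex A C).obj T).d 1 0 ≫ verticesToColimit T = 0 := by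
  rw [thomasonComplex_d_one_zero]
  refine (Preadditive.sub_comp _ _ _).trans (sub_eq_zero.2 ?_)
  have e (i : Fin 2) (f : (nerve C).obj (op ⦋1⦌)) : coprodSimplicesι T (op ⦋1⦌) f ≫
      (simplicialReplacementObj T).δ i ≫ verticesToColimit T = colimit.ι T (op ⟨⦋1⦌, f⟩) := by
    refine (Category.assoc _ _ _).symm.trans ?_
    rw [coprodSimplicesι_δ]
    refine (Category.assoc _ _ _).trans ((_ ≫= coprodSimplicesι_desc _ _ _ _).trans ?_)
    exact colimit.w T (SimplexOver.ofHom (SimplexCategory.δ i) f).op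
  exact coprodSimplices_hom_ext fun f => (e 0 f).trans (e 1 f).symm

/-- The map `H_0(C, T) ⟶ colim T`. -/
def thomasonZeroToColimit (T : (SimplexOver C)ᵒᵖ ⥤ A) :
    (thomasonHomology A C 0).obj T ⟶ colimit T :=
  homologyZeroDesc ((thomasonComplex A C).obj T) (verticesToColimit T) (d_verticesToColimit T)

lemma verticesToHomology_thomasonZeroToColimit (T : (SimplexOver C)ᵒᵖ ⥤ A) :
    verticesToHomology T ≫ thomasonZeroToColimit T = verticesToColimit T :=
  toHomologyZero_desc _ _ _

lemma thomasonHomology_zero_hom_ext {T : (SimplexOver C)ᵒᵖ ⥤ A} {X : A}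
    {g h : (thomasonHomology A C 0).obj T ⟶ X}
    (w : ∀ f : (nerve C).obj (op ⦋0⦌),
      coprodSimplicesι T (op ⦋0⦌) f ≫ verticesToHomology T ≫ g =
        coprodSimplicesι T (op ⦋0⦌) f ≫ verticesToHomology T ≫ h) :
    g = h := by
  rw [← cancel_epi (verticesToHomology T)]
  exact coprodSimplices_hom_ext w

lemma ι_thomasonZeroToColimit (T : (SimplexOver C)ᵒᵖ ⥤ A) (f : (nerve C).obj (op ⦋0⦌)) :
    coprodSimplicesι T (op ⦋0⦌) f ≫ verticesToHomology T ≫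
      thomasonZeroToColimit T = colimit.ι T (op ⟨⦋0⦌, f⟩) :=
  (_ ≫= verticesToHomology_thomasonZeroToColimit T).trans (coprodSimplicesι_desc _ _ _ _)

lemma vertexToHomology_thomasonZeroToColimit (T : (SimplexOver C)ᵒᵖ ⥤ A) {n : SimplexCategory}
    (w : ⦋0⦌ ⟶ n) (f : (nerve C).obj (op n)) :
    vertexToHomology T w f ≫ thomasonZeroToColimit T = colimit.ι T (op ⟨n, f⟩) := by
  unfold vertexToHomology
  rw [Category.assoc, Category.assoc]
  exact (_ ≫= ι_thomasonZeroToColimit T _).trans (colimit.w T (SimplexOver.ofHom w f).op)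

lemma vertexToHomology_id (T : (SimplexOver C)ᵒᵖ ⥤ A) (f : (nerve C).obj (op ⦋0⦌)) :
    vertexToHomology T (𝟙 _) f =
      coprodSimplicesι T (op ⦋0⦌) f ≫ verticesToHomology T :=
  (congrArg (· ≫ coprodSimplicesι T _ f ≫ verticesToHomology T)
    (T.map_id (op ⟨⦋0⦌, f⟩))).trans (Category.id_comp _)

/-- The inverse is induced by `vertexCocone`. One composite is tested on 0-simplices, whose only
vertex is the identity of [0], the other on the colimit legs. -/
instance (T : (SimplexOver C)ᵒᵖ ⥤ A) : IsIso (thomasonZeroToColimit T) := by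
  refine ⟨colimit.desc T (vertexCocone T), thomasonHomology_zero_hom_ext fun f => ?_,
    colimit.hom_ext fun x => ?_⟩
  · refine Eq.trans (b := colimit.ι T (op ⟨⦋0⦌, f⟩) ≫ colimit.desc T (vertexCocone T)) ?_ ?_
    · rw [← ι_thomasonZeroToColimit T f, Category.assoc, Category.assoc]
      rfl
    · rw [colimit.ι_desc, Category.comp_id, ← vertexToHomology_id]
      exact (vertexToHomology_eq T _ f).symm
  · refine (colimit.ι_desc_assoc (vertexCocone T) x _).trans (Eq.trans ?_ (Category.comp_id _).symm)
    exact vertexToHomology_thomasonZeroToColimit T _ _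

variable (A C) in
/-- Thomason homology in degree `0` is the colimit. -/
def thomasonHomologyZeroIso : thomasonHomology A C 0 ≅ colim :=
  NatIso.ofComponents (fun T => asIso (thomasonZeroToColimit T)) fun {T T'} τ => by
    refine thomasonHomology_zero_hom_ext fun f => ?_
    refine (_ ≫= (Category.assoc _ _ _).symm).trans ?_
    refine (_ ≫= ((toHomologyZero_naturality ((thomasonComplex A C).map τ)) =≫ _)).trans ?_
    refine (_ ≫= Category.assoc _ _ _).trans ?_
    refine (coprodSimplicesι_desc_assoc T _ _ f _).trans ?_
    refine (Category.assoc _ _ _).trans ?_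
    refine (_ ≫= ι_thomasonZeroToColimit T' f).trans ?_
    refine (ι_colimMap τ _).symm.trans ?_
    refine (ι_thomasonZeroToColimit T f =≫ colimMap τ).symm.trans ?_
    refine (Category.assoc _ _ _).trans ?_
    exact _ ≫= Category.assoc _ _ _

/-- Both sides agree on the summands indexed by 0-simplices, which generate H_0. This is the degree
0 input for identifying the induced maps by universality. -/
lemma thomasonDeltaChange_zero [AB4 A] {C' : Type v} [SmallCategory.{v} C'] (φ : C ⥤ C') :
    (thomasonDeltaChange A φ).app 0 ≫ (thomasonHomologyZeroIso A C').hom =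
      Functor.whiskerLeft _ (thomasonHomologyZeroIso A C).hom ≫
        colimChange (SimplexOver.map φ).op := by
  ext T'
  refine thomasonHomology_zero_hom_ext fun f => ?_
  refine (_ ≫= (Category.assoc _ _ _).symm).trans ?_
  refine (_ ≫= ((toHomologyZero_naturality ((thomasonComplexChange A φ).app T')) =≫ _)).trans ?_
  refine (_ ≫= Category.assoc _ _ _).trans ?_
  refine (coprodSimplicesι_desc_assoc ((SimplexOver.map φ).op ⋙ T') _ _ f _).trans ?_
  refine (Category.assoc _ _ _).trans ?_
  refine (Category.id_comp _).trans ?_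
  refine (ι_thomasonZeroToColimit T' _).trans ?_
  refine (colimit.ι_pre T' (SimplexOver.map φ).op (op ⟨⦋0⦌, f⟩)).symm.trans ?_
  refine (ι_thomasonZeroToColimit ((SimplexOver.map φ).op ⋙ T') f =≫ _).symm.trans ?_
  refine (Category.assoc _ _ _).trans ?_
  exact _ ≫= Category.assoc _ _ _

end ThomasonZero

/-! ### The decalage and its extra degeneracy -/

section Decalage

open scoped Simplicial

/-- The functor `[n] ↦ [n + 1]` on `Δ` which adds a new smallest element. -/
def addBot : SimplexCategory ⥤ SimplexCategory where
  obj n := ⦋n.len + 1⦌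
  map {m n} σ := SimplexCategory.Hom.mk
    { toFun := Fin.cases 0 fun i => (σ.toOrderHom i).succ
      monotone' i j h := by
        induction i using Fin.cases with
        | zero => exact Fin.zero_le _
        | succ i =>
          induction j using Fin.cases with
          | zero => simp at h
          | succ j => exact Fin.succ_le_succ_iff.2 (σ.toOrderHom.monotone (Fin.succ_le_succ_iff.1 h)) }
  map_id n := by
    ext i
    induction i using Fin.cases <;> rfl
  map_comp σ τ := by
    ext i
    induction i using Fin.cases <;> rfl

/-- The inclusion `[n] ⟶ [n + 1]` which misses the new smallest element. -/
def addBotι : 𝟭 SimplexCategory ⟶ addBot where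
  app n := SimplexCategory.Hom.mk ⟨Fin.succ, fun _ _ h => Fin.succ_le_succ_iff.2 h⟩

/-- The surjection `[n + 1] ⟶ [n]` which identifies the new smallest element with `0`. -/
def addBotσ (n : SimplexCategory) : addBot.obj n ⟶ n :=
  SimplexCategory.σ (n := n.len) 0

lemma addBotι_comp_σ (n : SimplexCategory) : addBotι.app n ≫ addBotσ n = 𝟙 n := by
  ext i
  exact congrArg Fin.val (Fin.predAbove_zero_succ (i := i))

/-- Since `addBot` raises the index of a coface by one, this is the cosimplicial identity σ⁰ ∘ δ¹ =
id. -/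
lemma addBot_map_δ_zero (n : ℕ) :
    addBot.map (SimplexCategory.δ (0 : Fin (n + 2))) ≫ addBotσ ⦋n + 1⦌ = 𝟙 _ := by
  ext i
  induction i using Fin.cases with
  | zero => rfl
  | succ i => exact congrArg Fin.val (Fin.predAbove_zero_succ (i := i.succ))

/-- After the index shift by `addBot`, this is the cosimplicial identity σ⁰ ∘ δ^(i+2) = δ^(i+1) ∘
σ⁰. -/
lemma addBot_map_δ_succ (n : ℕ) (i : Fin (n + 2)) :
    addBot.map (SimplexCategory.δ i.succ) ≫ addBotσ ⦋n + 2⦌ =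
      addBotσ ⦋n + 1⦌ ≫ addBot.map (SimplexCategory.δ i) := by
  ext j
  induction j using Fin.cases with
  | zero => rfl
  | succ j =>
    change Fin (n + 2) at j
    have h₁ : Fin.predAbove 0 (i.succ.succAbove j).succ = i.succ.succAbove j :=
      Fin.predAbove_zero_succ
    have h₂ : Fin.predAbove 0 j.succ = j := Fin.predAbove_zero_succ
    change (Fin.predAbove 0 (Fin.succ (i.succ.succAbove j))).val =
      (Fin.cases (motive := fun _ => Fin (n + 3)) 0 (fun k => (i.succAbove k).succ)
        (Fin.predAbove 0 j.succ) : Fin (n + 3)).val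
    rw [h₁, h₂]
    induction j using Fin.cases <;> simp

section DecalageSystem

variable {A : Type u} [Category.{v} A] [HasColimits A] {C : Type v} [SmallCategory.{v} C]

lemma nerve_map_map {k m n : SimplexCategory} (a : k ⟶ m) (b : m ⟶ n)
    (g : (nerve C).obj (op n)) :
    (nerve C).map a.op ((nerve C).map b.op g) = (nerve C).map (a ≫ b).op g :=
  rfl

/-- The simplices `f' : [n + 1] ⥤ C` which extend the simplex `f : [n] ⥤ C`. -/
abbrev Extension (x : SimplexOver C) : Type v :=
  { f' : (nerve C).obj (op (addBot.obj x.dim)) //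
    (nerve C).map (addBotι.app x.dim).op f' = x.diagram }

/-- The restriction of extensions along a morphism of `Δ/C`. -/
def Extension.restrict {x y : SimplexOver C} (u : x ⟶ y) (f' : Extension y) : Extension x :=
  ⟨(nerve C).map (addBot.map u.toHom).op f'.1, by
    have h₁ := nerve_map_map (addBotι.app x.dim) (addBot.map u.toHom) f'.1
    have h₂ := nerve_map_map u.toHom (addBotι.app y.dim) f'.1
    have h₃ : u.toHom ≫ addBotι.app y.dim = addBotι.app x.dim ≫ addBot.map u.toHom :=
      addBotι.naturality u.toHom
    rw [h₁, ← h₃]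
    exact h₂.symm.trans ((congrArg ((nerve C).map u.toHom.op) f'.2).trans u.w)⟩

/-- The coproduct of the `T(f')` over all extensions `f'` of a simplex. -/
abbrev decalageObj (T : (SimplexOver C)ᵒᵖ ⥤ A) (x : SimplexOver C) : A :=
  ∐ fun f' : Extension x => T.obj (op ⟨addBot.obj x.dim, f'.1⟩)

/-- The inclusion of the summand `T(f')`. -/
def decalageι (T : (SimplexOver C)ᵒᵖ ⥤ A) (x : SimplexOver C) (f' : Extension x) :
    T.obj (op ⟨addBot.obj x.dim, f'.1⟩) ⟶ decalageObj T x :=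
  Sigma.ι (fun f' : Extension x => T.obj (op ⟨addBot.obj x.dim, f'.1⟩)) f'

/-- The morphism out of the coproduct with given components. -/
def decalageDesc (T : (SimplexOver C)ᵒᵖ ⥤ A) (x : SimplexOver C) {X : A}
    (p : ∀ f' : Extension x, T.obj (op ⟨addBot.obj x.dim, f'.1⟩) ⟶ X) : decalageObj T x ⟶ X :=
  Sigma.desc p

lemma decalageι_desc (T : (SimplexOver C)ᵒᵖ ⥤ A) (x : SimplexOver C) {X : A}
    (p : ∀ f' : Extension x, T.obj (op ⟨addBot.obj x.dim, f'.1⟩) ⟶ X) (f' : Extension x) :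
    decalageι T x f' ≫ decalageDesc T x p = p f' :=
  Sigma.ι_desc _ _

lemma decalageObj_hom_ext {T : (SimplexOver C)ᵒᵖ ⥤ A} {x : SimplexOver C} {X : A}
    {p q : decalageObj T x ⟶ X}
    (h : ∀ f' : Extension x, decalageι T x f' ≫ p = decalageι T x f' ≫ q) : p = q :=
  Sigma.hom_ext _ _ h

/-- The map `T(g) ⟶ ∐ T(f')`, where `g` is a simplex such that `g ∘ a` is an extension. -/
def toDecalageObj (T : (SimplexOver C)ᵒᵖ ⥤ A) (x : SimplexOver C) {m : SimplexCategory}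
    (a : addBot.obj x.dim ⟶ m) (g : (nerve C).obj (op m))
    (h : (nerve C).map (addBotι.app x.dim).op ((nerve C).map a.op g) = x.diagram) :
    T.obj (op ⟨m, g⟩) ⟶ decalageObj T x :=
  -- Keeping `a` and `g` apart, with the index condition as a proof, turns equalities between maps
  -- into different-looking summands into equalities of morphisms of Δ, without transport along
  -- equalities of simplices.
  T.map (SimplexOver.ofHom a g).op ≫ decalageι T x ⟨(nerve C).map a.op g, h⟩

/-- The morphism `a` is a variable so that the lemma applies to `addBot.map (𝟙 _)`, which is only
propositionally the identity. -/
lemma toDecalageObj_id (T : (SimplexOver C)ᵒᵖ ⥤ A) (x : SimplexOver C) (f' : Extension x)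
    (a : addBot.obj x.dim ⟶ addBot.obj x.dim) (ha : a = 𝟙 _)
    (h : (nerve C).map (addBotι.app x.dim).op ((nerve C).map a.op f'.1) = x.diagram) :
    toDecalageObj T x a f'.1 h = decalageι T x f' := by
  subst ha
  exact (congrArg (· ≫ decalageι T x f') (T.map_id (op ⟨addBot.obj x.dim, f'.1⟩))).trans
    (Category.id_comp _)

lemma map_toDecalageObj (T : (SimplexOver C)ᵒᵖ ⥤ A) (x : SimplexOver C) {m k : SimplexCategory}
    (a : addBot.obj x.dim ⟶ m) (b : m ⟶ k) (g : (nerve C).obj (op k))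
    (h : (nerve C).map (addBotι.app x.dim).op ((nerve C).map (a ≫ b).op g) = x.diagram) :
    T.map (SimplexOver.ofHom b g).op ≫ toDecalageObj T x a ((nerve C).map b.op g) h =
      toDecalageObj T x (a ≫ b) g h := by
  unfold toDecalageObj
  rw [← T.map_comp_assoc]
  rfl

/-- The map of coproducts over extensions induced by a morphism of `Δ/C`. -/
def decalageMap (T : (SimplexOver C)ᵒᵖ ⥤ A) {x y : SimplexOver C} (u : x ⟶ y) :
    decalageObj T y ⟶ decalageObj T x :=
  decalageDesc T y fun f' => toDecalageObj T x (addBot.map u.toHom) f'.1 (f'.restrict u).2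

lemma decalageι_map (T : (SimplexOver C)ᵒᵖ ⥤ A) {x y : SimplexOver C} (u : x ⟶ y)
    (f' : Extension y) : decalageι T y f' ≫ decalageMap T u =
      toDecalageObj T x (addBot.map u.toHom) f'.1 (f'.restrict u).2 :=
  decalageι_desc _ _ _ _

lemma toDecalageObj_map (T : (SimplexOver C)ᵒᵖ ⥤ A) {x y : SimplexOver C} (u : x ⟶ y)
    {m : SimplexCategory} (a : addBot.obj y.dim ⟶ m) (g : (nerve C).obj (op m))
    (h : (nerve C).map (addBotι.app y.dim).op ((nerve C).map a.op g) = y.diagram) :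
    toDecalageObj T y a g h ≫ decalageMap T u =
      toDecalageObj T x (addBot.map u.toHom ≫ a) g
        (Extension.restrict u ⟨(nerve C).map a.op g, h⟩).2 := by
  unfold toDecalageObj
  rw [Category.assoc, decalageι_map]
  exact map_toDecalageObj T x (addBot.map u.toHom) a g _

/-- The Thomason natural system `f ↦ ∐ T(f')`, where `f'` runs through the extensions of `f`. -/
def decalageSystem (T : (SimplexOver C)ᵒᵖ ⥤ A) : (SimplexOver C)ᵒᵖ ⥤ A where
  obj x := decalageObj T x.unop
  map u := decalageMap T u.unop
  map_id x := decalageObj_hom_ext fun f' =>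
    (decalageι_map T _ f').trans ((toDecalageObj_id T _ _ _ (addBot.map_id _) _).trans
      (Category.comp_id _).symm)
  map_comp {x y z} u w := decalageObj_hom_ext fun f' => by
    refine (decalageι_map T _ _).trans ?_
    refine Eq.trans ?_ (Category.assoc _ _ _)
    refine Eq.trans ?_ ((decalageι_map T u.unop _).symm =≫ _)
    refine Eq.trans ?_ (toDecalageObj_map T w.unop _ _ _).symm
    congr 1
    exact addBot.map_comp _ _

/-- The map of decalages induced by a morphism of Thomason natural systems. -/
def decalageHomApp {T T' : (SimplexOver C)ᵒᵖ ⥤ A} (τ : T ⟶ T') (x : SimplexOver C) :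
    decalageObj T x ⟶ decalageObj T' x :=
  decalageDesc T x fun f' => τ.app (op ⟨addBot.obj x.dim, f'.1⟩) ≫ decalageι T' x f'

lemma decalageι_homApp {T T' : (SimplexOver C)ᵒᵖ ⥤ A} (τ : T ⟶ T') (x : SimplexOver C)
    (f' : Extension x) : decalageι T x f' ≫ decalageHomApp τ x =
      τ.app (op ⟨addBot.obj x.dim, f'.1⟩) ≫ decalageι T' x f' :=
  decalageι_desc _ _ _ _

lemma toDecalageObj_homApp {T T' : (SimplexOver C)ᵒᵖ ⥤ A} (τ : T ⟶ T') (x : SimplexOver C)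
    {m : SimplexCategory} (a : addBot.obj x.dim ⟶ m) (g : (nerve C).obj (op m))
    (h : (nerve C).map (addBotι.app x.dim).op ((nerve C).map a.op g) = x.diagram) :
    toDecalageObj T x a g h ≫ decalageHomApp τ x =
      τ.app (op ⟨m, g⟩) ≫ toDecalageObj T' x a g h := by
  unfold toDecalageObj
  rw [Category.assoc, decalageι_homApp]
  exact τ.naturality_assoc (SimplexOver.ofHom a g).op _

variable (A C) in
/-- The decalage as a functor of the Thomason natural system. -/
def decalage : ((SimplexOver C)ᵒᵖ ⥤ A) ⥤ ((SimplexOver C)ᵒᵖ ⥤ A) where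
  obj T := decalageSystem T
  map {T T'} τ :=
    { app x := decalageHomApp τ x.unop
      naturality {x y} u := decalageObj_hom_ext fun f' => by
        refine (Category.assoc _ _ _).symm.trans ?_
        refine (decalageι_map T u.unop f' =≫ _).trans ?_
        refine (toDecalageObj_homApp τ _ _ _ _).trans ?_
        refine Eq.trans ?_ (Category.assoc _ _ _)
        refine Eq.trans ?_ (decalageι_homApp τ x.unop f' =≫ _).symm
        refine Eq.trans ?_ (Category.assoc _ _ _).symm
        exact _ ≫= (decalageι_map T' u.unop f').symm }
  map_id T := by
    ext x
    exact decalageObj_hom_ext fun f' => (decalageι_homApp (𝟙 T) x.unop f').trans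
      ((Category.id_comp _).trans (Category.comp_id _).symm)
  map_comp {T T' T''} τ τ' := by
    ext x
    refine decalageObj_hom_ext fun f' => (decalageι_homApp (τ ≫ τ') x.unop f').trans ?_
    refine Eq.trans ?_ (Category.assoc _ _ _)
    refine Eq.trans ?_ (decalageι_homApp τ x.unop f' =≫ _).symm
    refine Eq.trans (Category.assoc _ _ _) (Eq.trans ?_ (Category.assoc _ _ _).symm)
    exact _ ≫= (decalageι_homApp τ' x.unop f').symm

/-- The morphism from a simplex to an extension. -/
def Extension.ι {x : SimplexOver C} (f' : Extension x) : x ⟶ ⟨addBot.obj x.dim, f'.1⟩ :=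
  SimplexOver.Hom.mk (addBotι.app x.dim) f'.2

/-- The map `∐ T(f') ⟶ T(f)` given by the inclusions `f ⟶ f'`. -/
def decalageCounitApp (T : (SimplexOver C)ᵒᵖ ⥤ A) (x : SimplexOver C) :
    decalageObj T x ⟶ T.obj (op x) :=
  decalageDesc T x fun f' => T.map f'.ι.op

lemma decalageι_counitApp (T : (SimplexOver C)ᵒᵖ ⥤ A) (x : SimplexOver C) (f' : Extension x) :
    decalageι T x f' ≫ decalageCounitApp T x = T.map f'.ι.op :=
  decalageι_desc _ _ _ _

lemma toDecalageObj_counitApp (T : (SimplexOver C)ᵒᵖ ⥤ A) (x : SimplexOver C)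
    {m : SimplexCategory} (a : addBot.obj x.dim ⟶ m) (g : (nerve C).obj (op m))
    (h : (nerve C).map (addBotι.app x.dim).op ((nerve C).map a.op g) = x.diagram) :
    toDecalageObj T x a g h ≫ decalageCounitApp T x =
      T.map (Quiver.Hom.op (X := x) (Y := ⟨m, g⟩)
        (SimplexOver.Hom.mk (addBotι.app x.dim ≫ a) h)) := by
  unfold toDecalageObj
  rw [Category.assoc, decalageι_counitApp, ← T.map_comp]
  rfl

/-- A section sends T(f) to the summand of the degenerate extension f ∘ σ⁰. It need not be natural
in x, but an objectwise section is enough for an epimorphism of functors. -/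
instance (T : (SimplexOver C)ᵒᵖ ⥤ A) (x : SimplexOver C) : Epi (decalageCounitApp T x) := by
  have h : (nerve C).map (addBotι.app x.dim).op
      ((nerve C).map (addBotσ x.dim).op x.diagram) = x.diagram := by
    rw [nerve_map_map, addBotι_comp_σ]
    rfl
  have e := toDecalageObj_counitApp T x (addBotσ x.dim) x.diagram h
  have e' : SimplexOver.Hom.mk (x := x) (y := x)
      (addBotι.app x.dim ≫ addBotσ x.dim) h = 𝟙 x :=
    SimplexOver.Hom.ext (addBotι_comp_σ _)
  have : SplitEpi (decalageCounitApp T x) :=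
    ⟨_, e.trans ((congrArg (fun w => T.map (Quiver.Hom.op w)) e').trans (T.map_id _))⟩
  exact this.epi

variable (A C) in
/-- The natural epimorphism from the decalage. -/
def decalageCounit : decalage A C ⟶ 𝟭 ((SimplexOver C)ᵒᵖ ⥤ A) where
  app T :=
    { app x := decalageCounitApp T x.unop
      naturality {x y} u := decalageObj_hom_ext fun f' => by
        refine (Category.assoc _ _ _).symm.trans ?_
        refine (decalageι_map T u.unop f' =≫ _).trans ?_
        refine (toDecalageObj_counitApp T _ _ _ _).trans ?_
        refine Eq.trans ?_ (Category.assoc _ _ _)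
        refine Eq.trans ?_ (decalageι_counitApp T x.unop f' =≫ _).symm
        refine Eq.trans ?_ (T.map_comp _ _)
        congr 2 }
  naturality {T T'} τ := by
    ext x
    refine decalageObj_hom_ext fun f' => ?_
    refine (Category.assoc _ _ _).symm.trans ?_
    refine (decalageι_homApp τ x.unop f' =≫ _).trans ?_
    refine (Category.assoc _ _ _).trans ?_
    refine (_ ≫= decalageι_counitApp T' x.unop f').trans ?_
    refine Eq.trans ?_ (Category.assoc _ _ _)
    refine Eq.trans ?_ (decalageι_counitApp T x.unop f' =≫ _).symm
    exact (τ.naturality _).symm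

instance [Abelian A] (T : (SimplexOver C)ᵒᵖ ⥤ A) : Epi ((decalageCounit A C).app T) :=
  @NatTrans.epi_of_epi_app _ _ _ _ _ _ _ fun x =>
    inferInstanceAs (Epi (decalageCounitApp T x.unop))

/-- The map from `T(g)` to degree `n` of the simplicial replacement of the decalage which is
given by `a : [n + 1] ⟶ [m]`. -/
def toDecalageReplacement (T : (SimplexOver C)ᵒᵖ ⥤ A) (n : SimplexCategory) {m : SimplexCategory}
    (a : addBot.obj n ⟶ m) (g : (nerve C).obj (op m)) :
    T.obj (op ⟨m, g⟩) ⟶ coprodSimplices (decalageSystem T) (op n) :=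
  toDecalageObj T ⟨n, (nerve C).map (addBotι.app n).op ((nerve C).map a.op g)⟩ a g rfl ≫
    coprodSimplicesι (decalageSystem T) (op n)
      ((nerve C).map (addBotι.app n).op ((nerve C).map a.op g))

/-- With `f` a variable, the equation `h` can be eliminated, so the result does not depend on how
the restricted simplex is written. -/
lemma toDecalageObj_ι (T : (SimplexOver C)ᵒᵖ ⥤ A) {n m : SimplexCategory}
    (f : (nerve C).obj (op n)) (a : addBot.obj n ⟶ m) (g : (nerve C).obj (op m))
    (h : (nerve C).map (addBotι.app n).op ((nerve C).map a.op g) = f) :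
    toDecalageObj T ⟨n, f⟩ a g h ≫ coprodSimplicesι (decalageSystem T) (op n) f =
      toDecalageReplacement T n a g := by
  subst h
  rfl

lemma decalageι_ι (T : (SimplexOver C)ᵒᵖ ⥤ A) {n : SimplexCategory} (f : (nerve C).obj (op n))
    (f' : Extension ⟨n, f⟩) :
    decalageι T ⟨n, f⟩ f' ≫ coprodSimplicesι (decalageSystem T) (op n) f =
      toDecalageReplacement T n (𝟙 _) f'.1 := by
  rw [← toDecalageObj_ι T f (𝟙 _) f'.1 f'.2]
  exact (toDecalageObj_id T ⟨n, f⟩ f' _ rfl f'.2).symm =≫ _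

lemma map_toDecalageReplacement (T : (SimplexOver C)ᵒᵖ ⥤ A) (n : SimplexCategory)
    {m k : SimplexCategory} (a : addBot.obj n ⟶ m) (b : m ⟶ k) (g : (nerve C).obj (op k)) :
    T.map (SimplexOver.ofHom b g).op ≫ toDecalageReplacement T n a ((nerve C).map b.op g) =
      toDecalageReplacement T n (a ≫ b) g := by
  refine (Category.assoc _ _ _).symm.trans ?_
  exact map_toDecalageObj T ⟨n, _⟩ a b g rfl =≫ _

/-- A simplex f together with an extension f' is the same as f' alone. Degree n of the replacement
of the decalage is therefore the coproduct of the T(f') over all f' : [n + 1] ⥤ C. -/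
lemma decalageReplacement_hom_ext {T : (SimplexOver C)ᵒᵖ ⥤ A} {n : SimplexCategory} {X : A}
    {p q : coprodSimplices (decalageSystem T) (op n) ⟶ X}
    (h : ∀ f' : (nerve C).obj (op (addBot.obj n)),
      toDecalageReplacement T n (𝟙 _) f' ≫ p = toDecalageReplacement T n (𝟙 _) f' ≫ q) :
    p = q := by
  refine coprodSimplices_hom_ext fun f => decalageObj_hom_ext fun f' => ?_
  have := h f'.1
  rw [← decalageι_ι T f f'] at this
  exact (Category.assoc _ _ _).symm.trans (this.trans (Category.assoc _ _ _))

/-- The morphism out of degree `n` of the simplicial replacement of the decalage with given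
components. -/
def decalageReplacementDesc (T : (SimplexOver C)ᵒᵖ ⥤ A) (n : SimplexCategory) {X : A}
    (p : ∀ f' : (nerve C).obj (op (addBot.obj n)), T.obj (op ⟨addBot.obj n, f'⟩) ⟶ X) :
    coprodSimplices (decalageSystem T) (op n) ⟶ X :=
  coprodSimplicesDesc (decalageSystem T) (op n) fun f => decalageDesc T ⟨n, f⟩ fun f' => p f'.1

lemma toDecalageReplacement_desc (T : (SimplexOver C)ᵒᵖ ⥤ A) (n : SimplexCategory) {X : A}
    (p : ∀ f' : (nerve C).obj (op (addBot.obj n)), T.obj (op ⟨addBot.obj n, f'⟩) ⟶ X)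
    {m : SimplexCategory} (a : addBot.obj n ⟶ m) (g : (nerve C).obj (op m)) :
    toDecalageReplacement T n a g ≫ decalageReplacementDesc T n p =
      T.map (SimplexOver.ofHom a g).op ≫ p ((nerve C).map a.op g) := by
  refine (Category.assoc _ _ _).trans ?_
  refine (_ ≫= coprodSimplicesι_desc (decalageSystem T) (op n) _ _).trans ?_
  refine (Category.assoc _ _ _).trans ?_
  exact _ ≫= decalageι_desc T _ _ _

/-- Under that description, simplicial operators act through `addBot`: the replacement of the
decalage is the replacement of T shifted by one degree. -/
lemma toDecalageReplacement_map (T : (SimplexOver C)ᵒᵖ ⥤ A) {n k : SimplexCategory} (σ : k ⟶ n)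
    {m : SimplexCategory} (a : addBot.obj n ⟶ m) (g : (nerve C).obj (op m)) :
    toDecalageReplacement T n a g ≫ (simplicialReplacementObj (decalageSystem T)).map σ.op =
      toDecalageReplacement T k (addBot.map σ ≫ a) g := by
  refine (Category.assoc _ _ _).trans ?_
  refine (_ ≫= coprodSimplicesι_desc (decalageSystem T) (op n) _ _).trans ?_
  refine (Category.assoc _ _ _).symm.trans ?_
  refine (toDecalageObj_map T (SimplexOver.ofHom σ _) a g rfl =≫ _).trans ?_
  exact toDecalageObj_ι T _ (addBot.map σ ≫ a) g _

/-- The extra degeneracy on the simplicial replacement of the decalage. -/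
def decalageExtra (T : (SimplexOver C)ᵒᵖ ⥤ A) (n : ℕ) :
    simplicialReplacementObj (decalageSystem T) _⦋n⦌ ⟶
      simplicialReplacementObj (decalageSystem T) _⦋n + 1⦌ :=
  -- The summand of f' goes to that of f' ∘ σ⁰, which repeats the first vertex and is regarded as an
  -- extension of f' itself.
  decalageReplacementDesc T ⦋n⦌ fun f' => toDecalageReplacement T ⦋n + 1⦌ (addBotσ ⦋n + 1⦌) f'

lemma toDecalageReplacement_extra (T : (SimplexOver C)ᵒᵖ ⥤ A) (n : ℕ) {m : SimplexCategory}
    (a : addBot.obj ⦋n⦌ ⟶ m) (g : (nerve C).obj (op m)) :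
    toDecalageReplacement T ⦋n⦌ a g ≫ decalageExtra T n =
      toDecalageReplacement T ⦋n + 1⦌ (addBotσ ⦋n + 1⦌ ≫ a) g :=
  (toDecalageReplacement_desc T ⦋n⦌ _ a g).trans
    (map_toDecalageReplacement T ⦋n + 1⦌ (addBotσ ⦋n + 1⦌) a g)

lemma decalageExtra_δ_zero (T : (SimplexOver C)ᵒᵖ ⥤ A) (n : ℕ) :
    decalageExtra T n ≫ (simplicialReplacementObj (decalageSystem T)).δ 0 = 𝟙 _ := by
  refine decalageReplacement_hom_ext fun f' => ?_
  refine (Category.assoc _ _ _).symm.trans ?_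
  refine (toDecalageReplacement_extra T n _ f' =≫ _).trans ?_
  refine (toDecalageReplacement_map T (SimplexCategory.δ 0) _ f').trans ?_
  refine Eq.trans ?_ (Category.comp_id _).symm
  congr 1
  exact (_ ≫= Category.comp_id _).trans (addBot_map_δ_zero n)

lemma decalageExtra_δ_succ (T : (SimplexOver C)ᵒᵖ ⥤ A) (n : ℕ) (i : Fin (n + 2)) :
    decalageExtra T (n + 1) ≫ (simplicialReplacementObj (decalageSystem T)).δ i.succ =
      (simplicialReplacementObj (decalageSystem T)).δ i ≫ decalageExtra T n := by
  refine decalageReplacement_hom_ext fun f' => ?_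
  refine (Category.assoc _ _ _).symm.trans (Eq.trans ?_ (Category.assoc _ _ _))
  refine (toDecalageReplacement_extra T (n + 1) _ f' =≫ _).trans ?_
  refine (toDecalageReplacement_map T (SimplexCategory.δ i.succ) _ f').trans ?_
  refine Eq.trans ?_ (toDecalageReplacement_map T (SimplexCategory.δ i) _ f' =≫ _).symm
  refine Eq.trans ?_ (toDecalageReplacement_extra T n _ f').symm
  congr 1
  refine (_ ≫= Category.comp_id _).trans ((addBot_map_δ_succ n i).trans ?_)
  exact (_ ≫= (Category.comp_id _).symm)

end DecalageSystem

/-! ### Universality of Thomason homology -/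

section Universal

variable {A : Type u} [Category.{v} A] [Abelian A] [HasColimits A]
  {C : Type v} [SmallCategory.{v} C]

/-- A simplicial object with a contraction of its positive degrees has no homology in positive
degrees. -/
lemma isZero_homology_succ_of_contraction {A : Type u} [Category.{v} A] [Abelian A]
    (X : SimplicialObject A)
    (s : ∀ n, X _⦋n⦌ ⟶ X _⦋n + 1⦌) (h₀ : ∀ n, s n ≫ X.δ 0 = 𝟙 _)
    (h₁ : ∀ (n : ℕ) (i : Fin (n + 2)), s (n + 1) ≫ X.δ i.succ = X.δ i ≫ s n) (n : ℕ) :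
    IsZero (((AlgebraicTopology.alternatingFaceMapComplex A).obj X).homology (n + 1)) := by
  -- Face 0 contributes the identity; the other faces commute past `s` with their index lowered by
  -- one, which reverses their signs.
  have e : s (n + 1) ≫ ((AlgebraicTopology.alternatingFaceMapComplex A).obj X).d (n + 2) (n + 1) =
      𝟙 _ - ((AlgebraicTopology.alternatingFaceMapComplex A).obj X).d (n + 1) n ≫ s n := by
    rw [AlgebraicTopology.alternatingFaceMapComplex_obj_d,
      AlgebraicTopology.alternatingFaceMapComplex_obj_d]
    refine (Preadditive.comp_sum _ _ _).trans ?_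
    rw [Fin.sum_univ_succ]
    refine Eq.trans ?_ (sub_eq_add_neg _ _).symm
    congr 1
    · simp [h₀]
    · refine Eq.trans ?_ (congrArg Neg.neg (Preadditive.sum_comp _ _ _).symm)
      rw [← Finset.sum_neg_distrib]
      refine Finset.sum_congr rfl fun i _ => ?_
      rw [Preadditive.comp_zsmul, Preadditive.zsmul_comp, h₁, Fin.val_succ, pow_succ]
      simp
  have hex : ((AlgebraicTopology.alternatingFaceMapComplex A).obj X).ExactAt (n + 1) := by
    rw [HomologicalComplex.exactAt_iff' _ (n + 2) (n + 1) n (by simp) (by simp),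
      ShortComplex.exact_iff_exact_up_to_refinements]
    intro Y x hx
    -- By `e`, a cycle `x` is the boundary of `x ≫ s (n + 1)`, so no refinement of `Y` is needed.
    refine ⟨Y, 𝟙 Y, inferInstance, x ≫ s (n + 1), ?_⟩
    refine (Category.id_comp x).trans (Eq.trans ?_ (Category.assoc _ _ _).symm)
    refine Eq.trans ?_ (x ≫= e.symm)
    refine Eq.trans ?_ (Preadditive.comp_sub _ _ _).symm
    refine Eq.trans ?_ (congrArg₂ (· - ·) (Category.comp_id _).symm
      ((Category.assoc _ _ _).symm.trans (hx =≫ s n)).symm)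
    exact ((congrArg (x - ·) (zero_comp (f := s n))).trans (sub_zero x)).symm
  exact hex.isZero_homology

variable (A C) in
theorem thomasonDelta_isUniversal [AB4 A] : (thomasonDelta A C).IsUniversal :=
  (thomasonDelta A C).isUniversal_of_coeffaceable (decalageCounit A C) fun n T =>
    isZero_homology_succ_of_contraction (simplicialReplacementObj (decalageSystem T))
      (decalageExtra T) (decalageExtra_δ_zero T) (decalageExtra_δ_succ T) n

variable (A C) in
/-- The derived colimit functors given by Thomason homology. -/
def thomasonDerivedColimits [AB4 A] : DerivedColimits A (SimplexOver C)ᵒᵖ where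
  toHomologicalDeltaFunctor := thomasonDelta A C
  zeroIso := thomasonHomologyZeroIso A C
  universal := thomasonDelta_isUniversal A C

end Universal

end Decalage

/-! ### The functors ℤ Hom_Δ([n], dim -) and their contraction onto ℤ -/

section SimplexResolution

open scoped Simplicial

variable (C : Type v) [SmallCategory.{v} C]

/-- The forgetful functor `Δ/C ⥤ Δ`. -/
def SimplexOver.forgetDim : SimplexOver C ⥤ SimplexCategory where
  obj x := x.dim
  map f := f.toHom

/-- The simplicial object `[n] ↦ ℤ Hom_Δ([n], dim -)` in `Fun(Δ/C, Ab)`. -/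
def simplexRep : SimplicialObject ((SimplexOver C)ᵒᵖᵒᵖ ⥤ AddCommGrpCat.{v}) :=
  Functor.flip (unopUnop _ ⋙ SimplexOver.forgetDim C ⋙ SSet.stdSimplex.{v} ⋙
    (SimplicialObject.whiskering _ _).obj AddCommGrpCat.free)

variable {C}

/-- The generators of `ℤ Hom_Δ([n], dim x)`. -/
def simplexGen (x : SimplexOver C) {n : SimplexCategory} (σ : n ⟶ x.dim) :
    ((simplexRep C).obj (op n)).obj (op (op x)) :=
  FreeAbelianGroup.of (SSet.stdSimplex.objEquiv.symm σ)

lemma simplexRep_map_app_gen (x : SimplexOver C) {m n : SimplexCategory} (a : m ⟶ n)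
    (σ : n ⟶ x.dim) :
    ((simplexRep C).map a.op).app (op (op x)) (simplexGen x σ) = simplexGen x (a ≫ σ) :=
  FreeAbelianGroup.map_of_apply _

lemma simplexRep_obj_map_gen {x y : SimplexOver C} (u : x ⟶ y) {n : SimplexCategory}
    (σ : n ⟶ x.dim) :
    ((simplexRep C).obj (op n)).map u.op.op (simplexGen x σ) = simplexGen y (σ ≫ u.toHom) :=
  FreeAbelianGroup.map_of_apply _

/-- The morphism out of `ℤ Hom_Δ([n], dim x)` with given values on the generators. -/
def simplexRepLift (x : SimplexOver C) (n : SimplexCategory) {M : AddCommGrpCat.{v}}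
    (p : (n ⟶ x.dim) → M) : ((simplexRep C).obj (op n)).obj (op (op x)) ⟶ M :=
  AddCommGrpCat.ofHom (FreeAbelianGroup.lift fun σ => p (SSet.stdSimplex.objEquiv σ))

lemma simplexRepLift_gen (x : SimplexOver C) {n : SimplexCategory} {M : AddCommGrpCat.{v}}
    (p : (n ⟶ x.dim) → M) (σ : n ⟶ x.dim) :
    simplexRepLift x n p (simplexGen x σ) = p σ :=
  FreeAbelianGroup.lift_apply_of _ _

lemma simplexRep_obj_hom_ext {x : SimplexOver C} {n : SimplexCategory} {M : AddCommGrpCat.{v}}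
    {p q : ((simplexRep C).obj (op n)).obj (op (op x)) ⟶ M}
    (h : ∀ σ : n ⟶ x.dim, p (simplexGen x σ) = q (simplexGen x σ)) : p = q := by
  refine AddCommGrpCat.hom_ext (FreeAbelianGroup.lift_ext _ _ fun σ => ?_)
  exact h (SSet.stdSimplex.objEquiv σ)

/-- A map σ : [n] ⟶ dim x is a morphism of Δ/C from the restriction of x along σ, so the generator σ
is the image of an identity generator. Thus the identity generators at the n-simplices generate the
functor. -/
lemma simplexRep_hom_ext {n : SimplexCategory} {F : (SimplexOver C)ᵒᵖᵒᵖ ⥤ AddCommGrpCat.{v}}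
    {p q : (simplexRep C).obj (op n) ⟶ F}
    (h : ∀ f : (nerve C).obj (op n), p.app (op (op ⟨n, f⟩)) (simplexGen ⟨n, f⟩ (𝟙 n)) =
      q.app (op (op ⟨n, f⟩)) (simplexGen ⟨n, f⟩ (𝟙 n))) : p = q := by
  ext1
  ext1 x
  refine simplexRep_obj_hom_ext fun σ => ?_
  have e := simplexRep_obj_map_gen (SimplexOver.ofHom σ x.unop.unop.diagram) (𝟙 n)
  have e' : simplexGen x.unop.unop σ = ((simplexRep C).obj (op n)).map
      (SimplexOver.ofHom σ x.unop.unop.diagram).op.op (simplexGen _ (𝟙 n)) :=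
    ((congrArg (simplexGen x.unop.unop) (Category.id_comp σ)).symm.trans e.symm)
  rw [e']
  refine (NatTrans.naturality_apply p (SimplexOver.ofHom σ x.unop.unop.diagram).op.op _).trans ?_
  refine Eq.trans ?_
    (NatTrans.naturality_apply q (SimplexOver.ofHom σ x.unop.unop.diagram).op.op _).symm
  exact congrArg _ (h _)

/-- The morphism `ℤ Hom_Δ([n], dim -) ⟶ F` given by elements of `F(f)` for all `f : [n] ⥤ C`. -/
def simplexRepDesc (n : SimplexCategory) (F : (SimplexOver C)ᵒᵖᵒᵖ ⥤ AddCommGrpCat.{v})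
    (y : ∀ f : (nerve C).obj (op n), F.obj (op (op ⟨n, f⟩))) : (simplexRep C).obj (op n) ⟶ F where
  app x := simplexRepLift x.unop.unop n fun σ =>
    F.map (SimplexOver.ofHom σ x.unop.unop.diagram).op.op (y _)
  naturality := by
    rintro ⟨⟨⟨m, g⟩⟩⟩ ⟨⟨⟨k, f⟩⟩⟩ ⟨⟨⟨a, ha⟩⟩⟩
    change m ⟶ k at a
    change (nerve C).map a.op f = g at ha
    subst ha
    refine simplexRep_obj_hom_ext fun σ => ?_
    refine (ConcreteCategory.comp_apply _ _ _).trans ?_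
    refine Eq.trans ?_ (ConcreteCategory.comp_apply _ _ _).symm
    refine (congrArg (simplexRepLift (⟨k, f⟩ : SimplexOver C) n _)
      (simplexRep_obj_map_gen (SimplexOver.ofHom a f) σ)).trans ?_
    refine (simplexRepLift_gen _ _ _).trans ?_
    refine Eq.trans ?_ (congrArg (F.map (SimplexOver.ofHom a f).op.op)
      (simplexRepLift_gen (⟨m, (nerve C).map a.op f⟩ : SimplexOver C) _ σ).symm)
    exact F.map_comp_apply (SimplexOver.ofHom σ ((nerve C).map a.op f)).op.op
      (SimplexOver.ofHom a f).op.op _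

lemma simplexRepDesc_gen (n : SimplexCategory) (F : (SimplexOver C)ᵒᵖᵒᵖ ⥤ AddCommGrpCat.{v})
    (y : ∀ f : (nerve C).obj (op n), F.obj (op (op ⟨n, f⟩))) (f : (nerve C).obj (op n)) :
    (simplexRepDesc n F y).app (op (op ⟨n, f⟩)) (simplexGen ⟨n, f⟩ (𝟙 n)) = y f := by
  refine (simplexRepLift_gen _ _ _).trans ?_
  exact ConcreteCategory.congr_hom (F.map_id (op (op ⟨n, f⟩))) (y f)

/-- A morphism to F amounts to a free choice of one element of F(f) for each n-simplex f, and such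
elements lift along objectwise surjections. -/
instance (n : SimplexCategory) : Projective ((simplexRep C).obj (op n)) where
  factors {F G} f e he := by
    have he' (x : (SimplexOver C)ᵒᵖᵒᵖ) : Function.Surjective (e.app x) :=
      (AddCommGrpCat.epi_iff_surjective _).1 inferInstance
    choose s hs using he'
    refine ⟨simplexRepDesc n F fun g => s _ (f.app _ (simplexGen ⟨n, g⟩ (𝟙 n))),
      simplexRep_hom_ext fun g => ?_⟩
    refine Eq.trans ?_ (hs _ _)
    exact congrArg _ (simplexRepDesc_gen _ _ _ _)

lemma simplexRepDesc_apply (n : SimplexCategory) (F : (SimplexOver C)ᵒᵖᵒᵖ ⥤ AddCommGrpCat.{v})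
    (y : ∀ f : (nerve C).obj (op n), F.obj (op (op ⟨n, f⟩))) (x : SimplexOver C) (σ : n ⟶ x.dim) :
    (simplexRepDesc n F y).app (op (op x)) (simplexGen x σ) =
      F.map (SimplexOver.ofHom σ x.diagram).op.op (y _) :=
  simplexRepLift_gen _ _ _

lemma simplexRepDesc_const_apply (n : SimplexCategory) (M : AddCommGrpCat.{v}) (c : M)
    (x : SimplexOver C) (σ : n ⟶ x.dim) :
    (simplexRepDesc n ((Functor.const (SimplexOver C)ᵒᵖᵒᵖ).obj M) fun _ => c).app (op (op x))
      (simplexGen x σ) = c :=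
  simplexRepDesc_apply n ((Functor.const (SimplexOver C)ᵒᵖᵒᵖ).obj M) (fun _ => c) x σ

variable (C) in
/-- The augmentation `ℤ Hom_Δ([n], dim -) ⟶ ℤ`. -/
def simplexAugmentation (n : SimplexCategory) :
    (simplexRep C).obj (op n) ⟶ constZ (SimplexOver C)ᵒᵖ :=
  simplexRepDesc n ((Functor.const _).obj (AddCommGrpCat.of (ULift.{v} ℤ))) fun _ => ULift.up 1

lemma simplexAugmentation_gen (x : SimplexOver C) {n : SimplexCategory} (σ : n ⟶ x.dim) :
    (simplexAugmentation C n).app (op (op x)) (simplexGen x σ) = ULift.up.{v} (1 : ℤ) :=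
  simplexRepDesc_const_apply n (AddCommGrpCat.of (ULift.{v} ℤ)) (ULift.up 1) x σ

lemma simplexRep_map_augmentation {m n : SimplexCategory} (a : m ⟶ n) :
    (simplexRep C).map a.op ≫ simplexAugmentation C m = simplexAugmentation C n := by
  ext1
  ext1 x
  refine simplexRep_obj_hom_ext fun σ => ?_
  refine (ConcreteCategory.comp_apply _ _ _).trans ?_
  refine (congrArg ((simplexAugmentation C m).app x)
    (simplexRep_map_app_gen x.unop.unop a σ)).trans ?_
  exact (simplexAugmentation_gen _ _).trans (simplexAugmentation_gen _ _).symm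

variable (C) in
/-- The augmented simplicial object `ℤ Hom_Δ([n], dim -) ⟶ ℤ`. -/
def simplexRepAugmented :
    SimplicialObject.Augmented ((SimplexOver C)ᵒᵖᵒᵖ ⥤ AddCommGrpCat.{v}) where
  left := simplexRep C
  right := constZ (SimplexOver C)ᵒᵖ
  hom :=
    { app n := simplexAugmentation C n.unop
      naturality _ _ a := (simplexRep_map_augmentation a.unop).trans (Category.comp_id _).symm }

/-- The homomorphism from `ℤ` to an abelian group which is given by an element. -/
def multiplesULift (M : AddCommGrpCat.{v}) (c : M) : AddCommGrpCat.of (ULift.{v} ℤ) ⟶ M :=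
  AddCommGrpCat.ofHom ((zmultiplesHom M c).comp AddEquiv.ulift.toAddMonoidHom)

lemma multiplesULift_up_one (M : AddCommGrpCat.{v}) (c : M) :
    multiplesULift M c (ULift.up 1) = c :=
  one_smul ℤ c

lemma ulift_int_hom_ext {M : AddCommGrpCat.{v}} {p q : AddCommGrpCat.of (ULift.{v} ℤ) ⟶ M}
    (h : p (ULift.up.{v} (1 : ℤ)) = q (ULift.up.{v} (1 : ℤ))) : p = q := by
  refine AddCommGrpCat.hom_ext (AddMonoidHom.ext ?_)
  rintro ⟨k⟩
  have e : (ULift.up k : ULift.{v} ℤ) = k • (ULift.up.{v} (1 : ℤ)) := by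
    ext
    simp
  rw [e, map_zsmul, map_zsmul]
  exact congrArg (k • ·) h

/-- The section of the augmentation `ℤ Hom_Δ([0], dim x) ⟶ ℤ` given by the first vertex. -/
def simplexAugmentationSection (x : SimplexOver C) : AddCommGrpCat.of (ULift.{v} ℤ) ⟶
    ((simplexRep C).obj (op ⦋0⦌)).obj (op (op x)) :=
  multiplesULift _ (simplexGen x (SimplexCategory.const ⦋0⦌ x.dim 0))

/-- The map `ℤ Hom_Δ([n], dim x) ⟶ ℤ Hom_Δ([n + 1], dim x)` which extends `σ` by the first
vertex. -/
def simplexShift (x : SimplexOver C) (n : ℕ) :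
    ((simplexRep C).obj (op ⦋n⦌)).obj (op (op x)) ⟶
      ((simplexRep C).obj (op ⦋n + 1⦌)).obj (op (op x)) :=
  AddCommGrpCat.free.map ((SSet.Augmented.StandardSimplex.extraDegeneracy x.dim).s n)

lemma simplexShift_gen (x : SimplexOver C) (n : ℕ) (σ : ⦋n⦌ ⟶ x.dim) :
    simplexShift x n (simplexGen x σ) =
      simplexGen x (SSet.Augmented.StandardSimplex.shift σ) :=
  FreeAbelianGroup.map_of_apply _

lemma simplexAugmentationSection_augmentation (x : SimplexOver C) :
    simplexAugmentationSection x ≫ (simplexAugmentation C ⦋0⦌).app (op (op x)) = 𝟙 _ :=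
  ulift_int_hom_ext ((ConcreteCategory.comp_apply _ _ _).trans
    ((congrArg ((simplexAugmentation C ⦋0⦌).app (op (op x)))
      (multiplesULift_up_one _ _)).trans (simplexAugmentation_gen _ _)))

/-- The shift of a vertex σ runs from the first vertex to σ, and face 1 keeps the start. Every
generator is therefore sent to the first vertex. -/
lemma simplexShift_zero_δ_one (x : SimplexOver C) :
    simplexShift x 0 ≫ ((simplexRep C).δ (1 : Fin 2)).app (op (op x)) =
      (simplexAugmentation C ⦋0⦌).app (op (op x)) ≫ simplexAugmentationSection x := by
  refine simplexRep_obj_hom_ext fun σ => ?_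
  refine (ConcreteCategory.comp_apply _ _ _).trans ?_
  refine Eq.trans ?_ (ConcreteCategory.comp_apply _ _ _).symm
  refine (congrArg (((simplexRep C).δ (1 : Fin 2)).app (op (op x)))
    (simplexShift_gen x 0 σ)).trans ?_
  refine (simplexRep_map_app_gen x (SimplexCategory.δ (1 : Fin 2)) _).trans ?_
  refine Eq.trans ?_ (congrArg (simplexAugmentationSection x) (simplexAugmentation_gen x σ)).symm
  refine Eq.trans ?_ (multiplesULift_up_one _ _).symm
  congr 1
  ext i
  fin_cases i
  rfl

/-- The evaluation of the augmented simplicial object `ℤ Hom_Δ(-, dim x)` has an extra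
degeneracy. -/
def simplexRepExtraDegeneracy (x : SimplexOver C) :
    (((SimplicialObject.Augmented.whiskering _ _).obj ((evaluation _ _).obj (op (op x)))).obj
      (simplexRepAugmented C)).ExtraDegeneracy where
  s' := simplexAugmentationSection x
  s n := simplexShift x n
  s'_comp_ε := simplexAugmentationSection_augmentation x
  s₀_comp_δ₁ := simplexShift_zero_δ_one x
  -- The identities not involving the augmentation are images of those of the standard simplex under
  -- the free abelian group functor.
  s_comp_δ₀ n := (AddCommGrpCat.free.map_comp _ _).symm.trans
    ((congrArg AddCommGrpCat.free.map
      ((SSet.Augmented.StandardSimplex.extraDegeneracy x.dim).s_comp_δ₀ n)).trans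
      (AddCommGrpCat.free.map_id _))
  s_comp_δ n i := (AddCommGrpCat.free.map_comp _ _).symm.trans
    ((congrArg AddCommGrpCat.free.map
      ((SSet.Augmented.StandardSimplex.extraDegeneracy x.dim).s_comp_δ n i)).trans
      (AddCommGrpCat.free.map_comp _ _))
  s_comp_σ n i := (AddCommGrpCat.free.map_comp _ _).symm.trans
    ((congrArg AddCommGrpCat.free.map
      ((SSet.Augmented.StandardSimplex.extraDegeneracy x.dim).s_comp_σ n i)).trans
      (AddCommGrpCat.free.map_comp _ _))

end SimplexResolution

/-! ### The projective resolution of ℤ -/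

section Resolution

open scoped Simplicial

open AlgebraicTopology

section

universe v₁ v₂ u₁ u₂

variable {B : Type u₁} [Category.{v₁} B] [Abelian B] {B' : Type u₂} [Category.{v₂} B'] [Abelian B']

/-- An additive functor commutes with the alternating face map complex. -/
def mapAlternatingFaceMapComplexIso (F : B ⥤ B') [F.Additive] (X : SimplicialObject B) :
    (F.mapHomologicalComplex _).obj ((alternatingFaceMapComplex B).obj X) ≅
      (alternatingFaceMapComplex B').obj (((SimplicialObject.whiskering _ _).obj F).obj X) :=
  HomologicalComplex.Hom.isoOfComponents (fun _ => Iso.refl _) (by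
    rintro _ n rfl
    refine (Category.id_comp _).trans (Eq.trans ?_ (Category.comp_id _).symm)
    change ((alternatingFaceMapComplex B').obj
      (((SimplicialObject.whiskering B B').obj F).obj X)).d (n + 1) n =
      F.map (((alternatingFaceMapComplex B).obj X).d (n + 1) n)
    rw [alternatingFaceMapComplex_obj_d, alternatingFaceMapComplex_obj_d,
      AlternatingFaceMapComplex.objD, AlternatingFaceMapComplex.objD, F.map_sum]
    exact Finset.sum_congr rfl fun i _ => (F.map_zsmul).symm)

/-- The chain map from the alternating face map complex given by an augmentation. -/
def augmentationChainMap (X : SimplicialObject.Augmented B) :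
    (alternatingFaceMapComplex B).obj X.left ⟶ (ChainComplex.single₀ B).obj X.right :=
  AlternatingFaceMapComplex.ε.app X

lemma augmentationChainMap_f_zero (X : SimplicialObject.Augmented B) :
    (augmentationChainMap X).f 0 = X.hom.app (op ⦋0⦌) :=
  AlternatingFaceMapComplex.ε_app_f_zero X

/-- The target is concentrated in degree 0, so the two chain maps need comparing only there. -/
lemma map_augmentation_comp_single (F : B ⥤ B') [F.Additive] (X : SimplicialObject.Augmented B) :
    (F.mapHomologicalComplex _).map (augmentationChainMap X) ≫
        (HomologicalComplex.singleMapHomologicalComplex F _ 0).hom.app X.right =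
      (mapAlternatingFaceMapComplexIso F X.left).hom ≫ augmentationChainMap
        (((SimplicialObject.Augmented.whiskering _ _).obj F).obj X) := by
  apply HomologicalComplex.to_single_hom_ext
  refine (congrArg (F.map ((augmentationChainMap X).f 0) ≫ ·)
    (HomologicalComplex.singleMapHomologicalComplex_hom_app_self F _ 0 X.right)).trans ?_
  refine Eq.trans ?_ (Category.id_comp _).symm
  rw [augmentationChainMap_f_zero, augmentationChainMap_f_zero]
  refine (_ ≫= ((congrArg (· ≫ 𝟙 _) (F.map_id X.right)).trans (Category.id_comp _))).trans ?_
  exact (Category.comp_id _).trans (Category.comp_id _).symm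

/-- The extra degeneracy is required only after applying `F`. This matters when `F` evaluates at an
object of Δ/C: the contraction uses first vertices, which morphisms of Δ/C need not preserve. -/
lemma quasiIso_map_augmentation (F : B ⥤ B') [F.Additive] (X : SimplicialObject.Augmented B)
    (ed : (((SimplicialObject.Augmented.whiskering _ _).obj F).obj X).ExtraDegeneracy) :
    QuasiIso ((F.mapHomologicalComplex _).map (augmentationChainMap X)) := by
  have : QuasiIso (augmentationChainMap
      (((SimplicialObject.Augmented.whiskering _ _).obj F).obj X)) :=
    HomotopyEquiv.quasiIso_hom ed.homotopyEquiv
  have h : QuasiIso ((F.mapHomologicalComplex _).map (augmentationChainMap X) ≫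
      (HomologicalComplex.singleMapHomologicalComplex F _ 0).hom.app X.right) := by
    rw [map_augmentation_comp_single]
    exact @quasiIso_comp _ _ _ _ _ _ _ _ (mapAlternatingFaceMapComplexIso F X.left).hom
      (augmentationChainMap (((SimplicialObject.Augmented.whiskering _ _).obj F).obj X))
      _ _ _ inferInstance this
  exact quasiIso_of_comp_right _
    ((HomologicalComplex.singleMapHomologicalComplex F _ 0).hom.app X.right)

end

/-- The projective resolution of the constant functor `ℤ : Δ/C ⥤ Ab` by the functors
`ℤ Hom_Δ([n], dim -)`. -/
def simplexResolution (C : Type v) [SmallCategory.{v} C] :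
    ProjectiveResolution (constZ (SimplexOver C)ᵒᵖ) where
  complex := (alternatingFaceMapComplex _).obj (simplexRep C)
  projective n := inferInstanceAs (Projective ((simplexRep C).obj (op ⦋n⦌)))
  π := augmentationChainMap (simplexRepAugmented C)
  quasiIso := (HomologicalComplex.quasiIso_iff_evaluation
    (augmentationChainMap (simplexRepAugmented C))).2 fun ⟨⟨x⟩⟩ =>
      quasiIso_map_augmentation _ _ (simplexRepExtraDegeneracy x)

lemma simplexResolution_π_f_zero (C : Type v) [SmallCategory.{v} C] :
    (simplexResolution C).π.f 0 = simplexAugmentation C ⦋0⦌ :=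
  augmentationChainMap_f_zero (simplexRepAugmented C)

end Resolution

/-! ### The Thomason complex as a tensor product -/

section SimplexTensor

open scoped Simplicial

variable {A : Type u} [Category.{v} A] [Abelian A] [HasColimits A]
  {C : Type v} [SmallCategory.{v} C]

/-- The inclusion of `T(f)` in `ℤ Hom_Δ([n], dim -) ⊗ T` for `f : [n] ⥤ C`. -/
def simplexTensorι (T : (SimplexOver C)ᵒᵖ ⥤ A) (n : SimplexCategoryᵒᵖ) (f : (nerve C).obj n) :
    T.obj (op ⟨n.unop, f⟩) ⟶ tensorObj T ((simplexRep C).obj n) :=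
  tensorι T ((simplexRep C).obj n) (op ⟨n.unop, f⟩) (simplexGen ⟨n.unop, f⟩ (𝟙 n.unop))

/-- The morphism out of `ℤ Hom_Δ([n], dim -) ⊗ T` with given components. -/
def simplexTensorDesc (T : (SimplexOver C)ᵒᵖ ⥤ A) (n : SimplexCategoryᵒᵖ) {X : A}
    (p : ∀ f : (nerve C).obj n, T.obj (op ⟨n.unop, f⟩) ⟶ X) :
    tensorObj T ((simplexRep C).obj n) ⟶ X :=
  -- By adjunction, a map to X is a morphism from `simplexRep` to Hom(T(-), X), hence a free choice
  -- of maps T(f) ⟶ X.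
  (tensorHomEquiv T ((simplexRep C).obj n) X).symm
    (simplexRepDesc n.unop ((homFunctor T).obj X) p)

lemma simplexTensorι_desc (T : (SimplexOver C)ᵒᵖ ⥤ A) (n : SimplexCategoryᵒᵖ) {X : A}
    (p : ∀ f : (nerve C).obj n, T.obj (op ⟨n.unop, f⟩) ⟶ X) (f : (nerve C).obj n) :
    simplexTensorι T n f ≫ simplexTensorDesc T n p = p f :=
  (tensorι_homEquiv_symm _ _ _).trans
    (simplexRepDesc_gen n.unop ((homFunctor T).obj X) p f)

lemma simplexTensor_hom_ext {T : (SimplexOver C)ᵒᵖ ⥤ A} {n : SimplexCategoryᵒᵖ} {X : A}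
    {g h : tensorObj T ((simplexRep C).obj n) ⟶ X}
    (w : ∀ f, simplexTensorι T n f ≫ g = simplexTensorι T n f ≫ h) : g = h :=
  (tensorHomEquiv T ((simplexRep C).obj n) X).injective
    (simplexRep_hom_ext (n := n.unop) fun f => w f)

/-- The isomorphism between the coproduct of the `T(f)` over all `f : [n] ⥤ C` and
`ℤ Hom_Δ([n], dim -) ⊗ T`. -/
def coprodSimplicesIsoTensor (T : (SimplexOver C)ᵒᵖ ⥤ A) (n : SimplexCategoryᵒᵖ) :
    coprodSimplices T n ≅ tensorObj T ((simplexRep C).obj n) where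
  hom := coprodSimplicesDesc T n (simplexTensorι T n)
  inv := simplexTensorDesc T n (coprodSimplicesι T n)
  hom_inv_id := coprodSimplices_hom_ext fun f => by
    rw [coprodSimplicesι_desc_assoc, simplexTensorι_desc, Category.comp_id]
  inv_hom_id := simplexTensor_hom_ext fun f => by
    rw [← Category.assoc, simplexTensorι_desc, coprodSimplicesι_desc, Category.comp_id]

lemma coprodSimplicesι_isoTensor (T : (SimplexOver C)ᵒᵖ ⥤ A) (n : SimplexCategoryᵒᵖ)
    (f : (nerve C).obj n) :
    coprodSimplicesι T n f ≫ (coprodSimplicesIsoTensor T n).hom = simplexTensorι T n f :=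
  coprodSimplicesι_desc _ _ _ _

/-- Restricting the identity generator at f along a gives the generator a, which is the image of the
identity generator at f ∘ a; the tensor relation then moves a across to T. -/
lemma simplexTensorι_map (T : (SimplexOver C)ᵒᵖ ⥤ A) {n m : SimplexCategoryᵒᵖ} (a : n ⟶ m)
    (f : (nerve C).obj n) :
    simplexTensorι T n f ≫ tensorMapLeft T ((simplexRep C).map a) =
      T.map (SimplexOver.ofHom a.unop f).op ≫ simplexTensorι T m ((nerve C).map a f) := by
  refine (tensorι_mapLeft T ((simplexRep C).map a) _ _).trans ?_
  refine Eq.trans ?_ (tensorι_map T ((simplexRep C).obj m) (SimplexOver.ofHom a.unop f).op _)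
  refine congrArg (tensorι T ((simplexRep C).obj m) (op ⟨n.unop, f⟩)) ?_
  refine (simplexRep_map_app_gen ⟨n.unop, f⟩ a.unop (𝟙 n.unop)).trans ?_
  refine Eq.trans ?_ (simplexRep_obj_map_gen (SimplexOver.ofHom a.unop f) (𝟙 m.unop)).symm
  exact congrArg _ ((Category.comp_id a.unop).trans (Category.id_comp a.unop).symm)

lemma simplexTensorι_mapRight {T T' : (SimplexOver C)ᵒᵖ ⥤ A} (τ : T ⟶ T') (n : SimplexCategoryᵒᵖ)
    (f : (nerve C).obj n) :
    simplexTensorι T n f ≫ tensorMapRight τ ((simplexRep C).obj n) =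
      τ.app (op ⟨n.unop, f⟩) ≫ simplexTensorι T' n f :=
  tensorι_mapRight _ _ _ _

/-- The simplicial replacement of `T` is `ℤ Hom_Δ(-, dim -) ⊗ T`. -/
def simplicialReplacementIsoTensor (T : (SimplexOver C)ᵒᵖ ⥤ A) :
    simplicialReplacementObj T ≅
      ((SimplicialObject.whiskering _ _).obj (symbolicTensor T)).obj (simplexRep C) :=
  NatIso.ofComponents (fun n => coprodSimplicesIsoTensor T n) fun {n m} a =>
    coprodSimplices_hom_ext fun f => by
      refine (coprodSimplicesι_desc_assoc _ _ _ _ _).trans ?_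
      refine (Category.assoc _ _ _).trans ?_
      refine (_ ≫= coprodSimplicesι_isoTensor T m _).trans ?_
      refine (simplexTensorι_map T a f).symm.trans ?_
      exact (coprodSimplicesι_desc_assoc T n (simplexTensorι T n) f
        (tensorMapLeft T ((simplexRep C).map a))).symm

/-- The Thomason complex of `T` is the tensor product of the resolution of `ℤ` by the functors
`ℤ Hom_Δ([n], dim -)` with `T`. -/
def thomasonComplexIsoTensor (T : (SimplexOver C)ᵒᵖ ⥤ A) :
    (thomasonComplex A C).obj T ≅
      ((symbolicTensor T).mapHomologicalComplex _).obj (simplexResolution C).complex :=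
  (AlgebraicTopology.alternatingFaceMapComplex A).mapIso (simplicialReplacementIsoTensor T) ≪≫
    (mapAlternatingFaceMapComplexIso (symbolicTensor T) (simplexRep C)).symm

lemma thomasonComplexIsoTensor_hom_f (T : (SimplexOver C)ᵒᵖ ⥤ A) (n : ℕ) :
    (thomasonComplexIsoTensor T).hom.f n = (coprodSimplicesIsoTensor T (op ⦋n⦌)).hom :=
  Category.comp_id _

lemma thomasonComplexIsoTensor_naturality {T T' : (SimplexOver C)ᵒᵖ ⥤ A} (τ : T ⟶ T') :
    (thomasonComplex A C).map τ ≫ (thomasonComplexIsoTensor T').hom =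
      (thomasonComplexIsoTensor T).hom ≫
        (NatTrans.mapHomologicalComplex (symbolicTensorHom τ) _).app
          (simplexResolution C).complex := by
  refine HomologicalComplex.hom_ext _ _ fun n => ?_
  refine (_ ≫= thomasonComplexIsoTensor_hom_f T' n).trans ?_
  refine Eq.trans ?_ (thomasonComplexIsoTensor_hom_f T n =≫
    tensorMapRight τ ((simplexRep C).obj (op ⦋n⦌))).symm
  refine coprodSimplices_hom_ext fun f => ?_
  refine (coprodSimplicesι_desc_assoc _ _ _ _ _).trans ?_
  refine (Category.assoc _ _ _).trans ?_
  refine (_ ≫= coprodSimplicesι_isoTensor T' _ f).trans ?_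
  refine (simplexTensorι_mapRight τ _ f).symm.trans ?_
  exact (coprodSimplicesι_desc_assoc T _ (simplexTensorι T _) f _).symm

variable (A C) in
/-- Thomason homology of `T` is `Tor(ℤ, T)`. -/
def thomasonHomologyIsoTorZ (n : ℕ) : thomasonHomology A C n ≅ torZ A (SimplexOver C)ᵒᵖ n :=
  NatIso.ofComponents
    (fun T => (HomologicalComplex.homologyFunctor A _ n).mapIso (thomasonComplexIsoTensor T) ≪≫
      ((simplexResolution C).isoLeftDerivedObj (symbolicTensor T) n).symm)
    fun {T T'} τ => by
      have h := (HomologicalComplex.homologyFunctor A _ n).congr_map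
        (thomasonComplexIsoTensor_naturality τ)
      rw [Functor.map_comp, Functor.map_comp] at h
      refine (Category.assoc _ _ _).symm.trans ((h =≫ _).trans ?_)
      refine Eq.trans ?_ (_ ≫= (ProjectiveResolution.leftDerived_app_eq (symbolicTensorHom τ)
        (simplexResolution C) n).symm)
      refine (Category.assoc _ _ _).trans (Eq.trans ?_ (Category.assoc _ _ _).symm)
      refine _ ≫= ?_
      exact (Iso.inv_hom_id_assoc _ _).symm

lemma thomasonHomologyIsoTorZ_hom_app (T : (SimplexOver C)ᵒᵖ ⥤ A) (n : ℕ) :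
    (thomasonHomologyIsoTorZ A C n).hom.app T =
      (HomologicalComplex.homologyFunctor A _ n).map (thomasonComplexIsoTensor T).hom ≫
        ((simplexResolution C).isoLeftDerivedObj (symbolicTensor T) n).inv := rfl

/-! ### Naturality in C of the comparison with Tor -/

section Change

variable {C' : Type v} [SmallCategory.{v} C'] (φ : C ⥤ C')

/-- The identification of `ℤ Hom_Δ([n], dim -)` on `Δ/C` with the restriction of the corresponding
functor on `Δ/C'`. -/
def simplexRepChange : simplexRep C ⟶
    ((SimplicialObject.whiskering _ _).obj (restrictAb (SimplexOver.map φ).op)).obj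
      (simplexRep C') where
  app n :=
    -- The functor Δ/φ leaves dimensions unchanged, so the two values agree definitionally.
    { app x := 𝟙 (((simplexRep C).obj n).obj x)
      naturality _ _ _ := (Category.comp_id _).trans (Category.id_comp _).symm }
  naturality n m a := by
    ext1
    ext1 x
    exact (Category.comp_id _).trans (Category.id_comp _).symm

/-- The identity chain map between the resolution of `ℤ` on `Δ/C` and the restriction of the
resolution of `ℤ` on `Δ/C'`. -/
def simplexResolutionChange : (simplexResolution C).complex ⟶
    ((restrictAb (SimplexOver.map φ).op).mapHomologicalComplex _).obj
      (simplexResolution C').complex :=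
  (AlgebraicTopology.alternatingFaceMapComplex _).map (simplexRepChange φ) ≫
    (mapAlternatingFaceMapComplexIso (restrictAb (SimplexOver.map φ).op) (simplexRep C')).inv

lemma simplexResolutionChange_f (n : ℕ) :
    (simplexResolutionChange φ).f n = (simplexRepChange φ).app (op ⦋n⦌) :=
  Category.comp_id _

/-- Both augmentations send every generator to 1. This is the lifting condition that
`leftDerivedChange_eq` requires. -/
lemma simplexResolutionChange_π :
    (simplexResolutionChange φ).f 0 ≫
        (restrictAb (SimplexOver.map φ).op).map ((simplexResolution C').π.f 0) =
      (simplexResolution C).π.f 0 ≫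
        (show constZ (SimplexOver C)ᵒᵖ ⟶
          (restrictAb (SimplexOver.map φ).op).obj (constZ (SimplexOver C')ᵒᵖ) from
            { app _ := 𝟙 _ }) := by
  refine (congrArg₂ (· ≫ ·) (simplexResolutionChange_f φ 0)
    (congrArg (restrictAb (SimplexOver.map φ).op).map (simplexResolution_π_f_zero C'))).trans ?_
  refine Eq.trans ?_ (simplexResolution_π_f_zero C =≫ _).symm
  ext1
  ext1 x
  exact (Category.id_comp _).trans (Category.comp_id _).symm

variable {φ} {T : (SimplexOver C)ᵒᵖ ⥤ A} {T' : (SimplexOver C')ᵒᵖ ⥤ A}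
  (τ : T ⟶ (SimplexOver.map φ).op ⋙ T')

lemma simplexTensorι_change (n : SimplexCategoryᵒᵖ) (f : (nerve C).obj n) :
    simplexTensorι T n f ≫ tensorMapLeft T ((simplexRepChange φ).app n) ≫
        tensorChange (SimplexOver.map φ).op τ ((simplexRep C').obj n) =
      simplexComponent φ τ n f ≫ simplexTensorι T' n ((nerveMap φ).app n f) :=
  (tensorι_mapLeft_assoc T ((simplexRepChange φ).app n) _ _ _).trans
    (tensorι_change (SimplexOver.map φ).op τ ((simplexRep C').obj n) _ _)

/-- On the summand T(f) both sides are τ_f followed by the inclusion of the summand of φ ∘ f. -/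
lemma thomasonComplexIsoTensor_change :
    (AlgebraicTopology.alternatingFaceMapComplex A).map
        (X := simplicialReplacementObj T) (Y := simplicialReplacementObj T')
        (simplicialReplacementMap φ τ) ≫ (thomasonComplexIsoTensor T').hom =
      (thomasonComplexIsoTensor T).hom ≫
        ((symbolicTensor T).mapHomologicalComplex _).map (simplexResolutionChange φ) ≫
          complexChange (symbolicTensorChange (SimplexOver.map φ).op τ)
            (simplexResolution C').complex := by
  refine HomologicalComplex.hom_ext _ _ fun n => ?_
  refine (_ ≫= thomasonComplexIsoTensor_hom_f T' n).trans ?_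
  refine Eq.trans ?_ (congrArg₂ (· ≫ ·) (thomasonComplexIsoTensor_hom_f T n)
    (congrArg (tensorMapLeft T) (simplexResolutionChange_f φ n) =≫
      tensorChange (SimplexOver.map φ).op τ ((simplexRep C').obj (op ⦋n⦌)))).symm
  refine coprodSimplices_hom_ext fun f => ?_
  refine (coprodSimplicesι_desc_assoc _ _ _ _ _).trans ?_
  refine (Category.assoc _ _ _).trans ?_
  refine (_ ≫= coprodSimplicesι_isoTensor T' _ _).trans ?_
  refine (simplexTensorι_change τ _ f).symm.trans ?_
  exact (coprodSimplicesι_desc_assoc T _ (simplexTensorι T _) f _).symm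

lemma thomasonHomologyIsoTorZ_change (n : ℕ) :
    thomasonHomologyMap φ τ n ≫ (thomasonHomologyIsoTorZ A C' n).hom.app T' =
      (thomasonHomologyIsoTorZ A C n).hom.app T ≫ torZMap (SimplexOver.map φ).op τ n := by
  rw [torZMap, leftDerivedChange_eq _ _ n (simplexResolution C) (simplexResolution C')
    (simplexResolutionChange φ) (simplexResolutionChange_π φ),
    thomasonHomologyIsoTorZ_hom_app, thomasonHomologyIsoTorZ_hom_app]
  have h := (((HomologicalComplex.homologyFunctor A _ n).map_comp _ _).symm.trans
    ((HomologicalComplex.homologyFunctor A _ n).congr_map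
      (thomasonComplexIsoTensor_change τ))).trans
        ((HomologicalComplex.homologyFunctor A _ n).map_comp _ _)
  refine (Category.assoc _ _ _).symm.trans ((h =≫ _).trans ?_)
  refine (Category.assoc _ _ _).trans (Eq.trans ?_ (Category.assoc _ _ _).symm)
  exact _ ≫= (Iso.inv_hom_id_assoc _ _).symm

end Change

end SimplexTensor

/-! ### Uniqueness of left derived functors -/

section Comparison

universe v₁ v₂ v₃ u₁ u₂ u₃

variable {B : Type u₁} [Category.{v₁} B] [Abelian B] {A : Type u₂} [Category.{v₂} A] [Abelian A]
  {B' : Type u₃} [Category.{v₃} B'] [Abelian B']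

namespace HomologicalDeltaFunctor

variable {S T U : HomologicalDeltaFunctor B A}

/-- The identity morphism of a homological `δ`-functor. -/
def Hom.refl (T : HomologicalDeltaFunctor B A) : Hom T T where
  app _ := 𝟙 _
  comm _ _ _ := (Category.comp_id _).trans (Category.id_comp _).symm

/-- The composition of morphisms of homological `δ`-functors. -/
def Hom.comp (g : Hom S T) (h : Hom T U) : Hom S U where
  app n := g.app n ≫ h.app n
  comm X hX n := by
    rw [NatTrans.comp_app, NatTrans.comp_app, Category.assoc, ← h.comm, ← Category.assoc,
      g.comm, Category.assoc]

/-- The composition of a morphism of homological `δ`-functors with an exact functor. -/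
def Hom.precomp (g : Hom S T) (R : B' ⥤ B) [R.Additive] [PreservesFiniteLimits R]
    [PreservesFiniteColimits R] : Hom (S.precomp R) (T.precomp R) where
  app n := Functor.whiskerLeft R (g.app n)
  comm X hX n := g.comm (X.map R) (hX.map_of_exact R) n

lemma IsUniversal.hom_ext (hT : T.IsUniversal) {g h : Hom S T} (e : g.app 0 = h.app 0) : g = h :=
  (hT S (h.app 0)).unique e rfl

end HomologicalDeltaFunctor

open HomologicalDeltaFunctor

namespace LeftDerivedFunctors

variable {F : B ⥤ A}

/-- The comparison morphism between two choices of left derived functors. -/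
def compare (L M : LeftDerivedFunctors F) :
    L.toHomologicalDeltaFunctor.Hom M.toHomologicalDeltaFunctor :=
  (M.universal L.toHomologicalDeltaFunctor (L.zeroIso.hom ≫ M.zeroIso.inv)).choose

lemma compare_app_zero (L M : LeftDerivedFunctors F) :
    (compare L M).app 0 = L.zeroIso.hom ≫ M.zeroIso.inv :=
  (M.universal L.toHomologicalDeltaFunctor (L.zeroIso.hom ≫ M.zeroIso.inv)).choose_spec.1

/-- An endomorphism of a universal δ-functor is determined in degree 0, where the two comparisons
cancel. -/
lemma compare_comp_compare (L M : LeftDerivedFunctors F) :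
    (compare L M).comp (compare M L) = Hom.refl _ := by
  refine L.universal.hom_ext ?_
  change (compare L M).app 0 ≫ (compare M L).app 0 = 𝟙 _
  rw [compare_app_zero, compare_app_zero, Category.assoc, Iso.inv_hom_id_assoc, Iso.hom_inv_id]

/-- The comparison isomorphisms between two choices of left derived functors. -/
def compareIso (L M : LeftDerivedFunctors F) (n : ℕ) : L.functor n ≅ M.functor n where
  hom := (compare L M).app n
  inv := (compare M L).app n
  hom_inv_id := congrArg (fun h : Hom _ _ => h.app n) (compare_comp_compare L M)
  inv_hom_id := congrArg (fun h : Hom _ _ => h.app n) (compare_comp_compare M L)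

end LeftDerivedFunctors

end Comparison

/-! ### Naturality of the comparison with derived colimits -/

section DerivedColimitComparison

open HomologicalDeltaFunctor LeftDerivedFunctors

variable {A : Type u} [Category.{v} A] [Abelian A] [HasColimits A]
  {I K : Type v} [SmallCategory.{v} I] [SmallCategory.{v} K]

lemma derivedColimChange_app_zero (w : I ⥤ K) (L : DerivedColimits A I) (M : DerivedColimits A K) :
    (derivedColimChange w L M).app 0 =
      Functor.whiskerLeft _ L.zeroIso.hom ≫ colimChange w ≫ M.zeroIso.inv :=
  (M.universal (L.precomp ((Functor.whiskeringLeft I K A).obj w))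
    (Functor.whiskerLeft _ L.zeroIso.hom ≫ colimChange w ≫ M.zeroIso.inv)).choose_spec.1

/-- Both composites end in a universal δ-functor, so only degree 0 matters; there both are the
canonical map of colimits conjugated by the degree 0 identifications. -/
lemma derivedColimChange_compare (w : I ⥤ K) (L L' : DerivedColimits A I)
    (M M' : DerivedColimits A K) :
    (derivedColimChange w L M).comp (compare M M') =
      ((compare L L').precomp ((Functor.whiskeringLeft I K A).obj w)).comp
        (derivedColimChange w L' M') := by
  refine M'.universal.hom_ext ?_
  change (derivedColimChange w L M).app 0 ≫ (compare M M').app 0 =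
    Functor.whiskerLeft _ ((compare L L').app 0) ≫ (derivedColimChange w L' M').app 0
  rw [derivedColimChange_app_zero, derivedColimChange_app_zero, compare_app_zero,
    compare_app_zero]
  ext E
  simp [precomp]

lemma derivedColimMap_compare (L L' : DerivedColimits A I) (M M' : DerivedColimits A K)
    (w : I ⥤ K) {D : I ⥤ A} {E : K ⥤ A} (τ : D ⟶ w ⋙ E) (n : ℕ) :
    derivedColimMap L M w τ n ≫ (compareIso M M' n).hom.app E =
      (compareIso L L' n).hom.app D ≫ derivedColimMap L' M' w τ n := by
  have h : ((derivedColimChange w L M).app n).app E ≫ ((compare M M').app n).app E =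
      ((compare L L').app n).app (w ⋙ E) ≫ ((derivedColimChange w L' M').app n).app E :=
    congrArg (fun g : Hom _ _ => (g.app n).app E) (derivedColimChange_compare w L L' M M')
  refine (Category.assoc _ _ _).trans ((_ ≫= h).trans ?_)
  exact ((compare L L').app n).naturality_assoc τ _

variable [AB4 A] {C C' : Type v} [SmallCategory.{v} C] [SmallCategory.{v} C']

/-- The explicit map on complexes and the abstract one are morphisms into the same universal
δ-functor, and `thomasonDeltaChange_zero` compares them in degree 0. -/
lemma thomasonDeltaChange_eq (φ : C ⥤ C') :
    thomasonDeltaChange A φ = derivedColimChange (SimplexOver.map φ).op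
      (thomasonDerivedColimits A C) (thomasonDerivedColimits A C') := by
  refine (thomasonDerivedColimits A C').universal.hom_ext ?_
  refine Eq.trans ?_ (derivedColimChange_app_zero (SimplexOver.map φ).op
    (thomasonDerivedColimits A C) (thomasonDerivedColimits A C')).symm
  refine Eq.trans ?_ (Category.assoc _ _ _)
  exact (Iso.eq_comp_inv _).2 (thomasonDeltaChange_zero φ)

lemma thomasonHomologyMap_eq_derivedColimMap (φ : C ⥤ C') {T : (SimplexOver C)ᵒᵖ ⥤ A}
    {T' : (SimplexOver C')ᵒᵖ ⥤ A} (τ : T ⟶ (SimplexOver.map φ).op ⋙ T') (n : ℕ) :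
    thomasonHomologyMap φ τ n = derivedColimMap (thomasonDerivedColimits A C)
      (thomasonDerivedColimits A C') (SimplexOver.map φ).op τ n := by
  rw [thomasonHomologyMap_eq, thomasonDeltaChange_eq]
  rfl

end DerivedColimitComparison

end Thomason

end

theorem mainTheorem2 {A : Type u} [Category.{v} A] [Abelian A] [HasColimits A] [AB4 A] :
    ∃ e : ∀ (C : Type v) [SmallCategory.{v} C] (n : ℕ),
      thomasonHomology A C n ≅ torZ A (SimplexOver C)ᵒᵖ n,
    (∀ (C C' : Type v) [SmallCategory.{v} C] [SmallCategory.{v} C'] (φ : C ⥤ C')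
      (T : (SimplexOver C)ᵒᵖ ⥤ A) (T' : (SimplexOver C')ᵒᵖ ⥤ A)
      (τ : T ⟶ (SimplexOver.map φ).op ⋙ T') (n : ℕ),
      thomasonHomologyMap φ τ n ≫ (e C' n).hom.app T' =
        (e C n).hom.app T ≫ torZMap (SimplexOver.map φ).op τ n) ∧
    (∀ (C : Type v) [SmallCategory.{v} C], Nonempty (DerivedColimits A (SimplexOver C)ᵒᵖ)) ∧
    ∀ L : ∀ (C : Type v) [SmallCategory.{v} C], DerivedColimits A (SimplexOver C)ᵒᵖ,
      ∃ e' : ∀ (C : Type v) [SmallCategory.{v} C] (n : ℕ),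
        torZ A (SimplexOver C)ᵒᵖ n ≅ (L C).functor n,
      ∀ (C C' : Type v) [SmallCategory.{v} C] [SmallCategory.{v} C'] (φ : C ⥤ C')
        (T : (SimplexOver C)ᵒᵖ ⥤ A) (T' : (SimplexOver C')ᵒᵖ ⥤ A)
        (τ : T ⟶ (SimplexOver.map φ).op ⋙ T') (n : ℕ),
        torZMap (SimplexOver.map φ).op τ n ≫ (e' C' n).hom.app T' =
          (e' C n).hom.app T ≫ derivedColimMap (L C) (L C') (SimplexOver.map φ).op τ n := by
  refine ⟨fun C _ n => thomasonHomologyIsoTorZ A C n,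
    fun C C' _ _ φ T T' τ n => thomasonHomologyIsoTorZ_change τ n,
    fun C _ => ⟨thomasonDerivedColimits A C⟩, fun L =>
    ⟨fun C _ n => (thomasonHomologyIsoTorZ A C n).symm ≪≫
      LeftDerivedFunctors.compareIso (thomasonDerivedColimits A C) (L C) n, ?_⟩⟩
  intro C C' _ _ φ T T' τ n
  have h₁ := thomasonHomologyIsoTorZ_change (A := A) τ n
  have h₂ := derivedColimMap_compare (thomasonDerivedColimits A C) (L C)
    (thomasonDerivedColimits A C') (L C') (SimplexOver.map φ).op τ n
  rw [← thomasonHomologyMap_eq_derivedColimMap] at h₂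
  -- The naturality square for Tor, read for the inverse isomorphisms, is pasted to the square `h₂`
  -- between the two choices of derived colimits.
  have h₃ : torZMap (SimplexOver.map φ).op τ n ≫ (thomasonHomologyIsoTorZ A C' n).inv.app T' =
      (thomasonHomologyIsoTorZ A C n).inv.app T ≫ thomasonHomologyMap φ τ n := by
    rw [← cancel_mono ((thomasonHomologyIsoTorZ A C' n).hom.app T'), Category.assoc,
      Category.assoc, h₁, Iso.inv_hom_id_app, Iso.inv_hom_id_app_assoc, Category.comp_id]
  change torZMap (SimplexOver.map φ).op τ n ≫ (thomasonHomologyIsoTorZ A C' n).inv.app T' ≫ _ =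
    ((thomasonHomologyIsoTorZ A C n).inv.app T ≫ _) ≫ _
  rw [← Category.assoc, h₃, Category.assoc]
  exact (_ ≫= h₂).trans (Category.assoc _ _ _).symm
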